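/- **Theorem.** Let $\mathcal M$ and $\mathcal W$ be finite sets of men and women, and let $N=\min(|\mathcal M|,|\mathcal W|)$. Each person $p$ has a deterministic set of $d_p\ge 1$ acceptable persons of the opposite sex and gives each of them a positive popularity $\mathcal D_p(\cdot)$ (its total over the acceptable partners may, but need not, be scaled to $1$). Each person $p$ has *popularity preferences*: $p$'s preference list is random and is obtained by drawing all acceptable partners successively without replacement, the favourite first, each draw being made with probability proportional to $\mathcal D_p$ among the partners that remain. The lists of different persons are independent. A matching pairs some of the men with distinct women and leaves all other persons single. It is stable if no person would strictly prefer being single to their assigned partner (i.e. nobody is matched to an unacceptable partner), and no man $m$ and woman $w$ both strictly prefer each other to their situation in the matching (being single is preferred to every unacceptable partner and is less preferred than every acceptable one). A stable pair is a pair $(m,w)$ matched in at least one stable matching. Let $r\ge 1$ and suppose that for every man $m$ and woman $w$ who find each other acceptable, $\mathcal D_w(m)\le r\,\mathcal D_m(w)$ and $\mathcal D_m(w)\le r\,\mathcal D_w(m)$. Then $$\mathbb E[\text{number of stable pairs}]\;\le\; N(1+\ln r)+\sum_{w\in\mathcal W}\frac{\ln d_w}{2}+\sum_{m\in\mathcal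 M}\frac{\ln d_m}{2}.$$ Moreover, when $r=1$, the popularities are symmetric, that is $\mathcal D_w(m)=\mathcal D_m(w)$ for every mutually acceptable pair $(m,w)$, and $\mathbb E[\text{number of stable pairs}]\le N+N\ln N$ (with $0\ln 0=0$). -/

import Mathlib

open scoped NNReal ENNReal

namespace StableMarriage

/-! ### Preference lists and stable matchings

A preference list is the list of the acceptable partners, favourite first. A matching of the
men `M` with the women `W` is a partial bijection `μ : M ≃. W`; the situation of a man `m` is
`μ m : Option W`, that of a woman `w` is `μ.symm w : Option M`, and `none` means "single". -/

/-- Position of a situation in the preference list `l`: acceptable partners by their place in the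
list, then being single, then the unacceptable partners. (How the unacceptable partners are
ordered among themselves has no influence on stability; they are all put on the same level.) -/
def position {α : Type*} [DecidableEq α] (l : List α) : Option α → ℕ
  | some a => if a ∈ l then l.idxOf a else l.length + 1
  | none => l.length

/-- A person with preference list `l` strictly prefers situation `x` to situation `y`. -/
def Prefers {α : Type*} [DecidableEq α] (l : List α) (x y : Option α) : Prop :=
  position l x < position l y

/-- The matching `μ` is stable for the preference lists `P m` of the men and `Q w` of the women:
no man-woman pair is blocking, and nobody would prefer to remain single. -/
def IsStable {M W : Type*} [DecidableEq M] [DecidableEq W]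
    (P : M → List W) (Q : W → List M) (μ : M ≃. W) : Prop :=
  (∀ m w, ¬ (Prefers (Q w) (some m) (μ.symm w) ∧ Prefers (P m) (some w) (μ m))) ∧
    (∀ m, ¬ Prefers (P m) none (μ m)) ∧
    (∀ w, ¬ Prefers (Q w) none (μ.symm w))

/-- The stable pairs: the pairs matched by at least one stable matching. -/
def stablePairs {M W : Type*} [DecidableEq M] [DecidableEq W]
    (P : M → List W) (Q : W → List M) : Set (M × W) :=
  {x | ∃ μ : M ≃. W, IsStable P Q μ ∧ μ x.1 = some x.2}

/-! ### Popularity preferences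

The popularities given by a person to the persons in `α` are encoded as `D : α → ℝ≥0`, where
`D a = 0` means that `a` is unacceptable. Only the ratios of the popularities given by one person
matter for the law of the preference list; the total is not required to be `1`. -/

/-- The set of acceptable partners. -/
noncomputable def acceptable {α : Type*} [Fintype α] (D : α → ℝ≥0) : Finset α :=
  {a | D a ≠ 0}

/-- Draw one partner, with probability proportional to the popularities `D`. -/
noncomputable def drawOne {α : Type*} [Fintype α] (D : α → ℝ≥0) (hD : D ≠ 0) : PMF α :=
  PMF.normalize (fun a => (D a : ℝ≥0∞))
    (by
      rw [tsum_fintype]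
      intro h
      apply hD
      funext a
      simpa using (Finset.sum_eq_zero_iff.mp h) a (Finset.mem_univ a))
    (by
      rw [tsum_fintype]
      exact ENNReal.sum_ne_top.mpr fun a _ => ENNReal.coe_ne_top)

open Classical in
/-- Draw successively, without replacement, `k` partners (or fewer if the acceptable ones are
exhausted before), each time with probability proportional to the popularities of those that
remain; the result is listed in the order of the draws. -/
noncomputable def drawList {α : Type*} [Fintype α] : ℕ → (α → ℝ≥0) → PMF (List α)
  | 0, _ => PMF.pure []
  | k + 1, D =>
    if hD : D ≠ 0 then
      (drawOne D hD).bind fun a => (drawList k (Function.update D a 0)).map (fun l => a :: l)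
    else PMF.pure []

/-- Popularity preferences: the random preference list of a person who gives popularities `D`,
obtained by drawing all acceptable partners, from the favourite one to the least favourite one. -/
noncomputable def popularityList {α : Type*} [Fintype α] (D : α → ℝ≥0) : PMF (List α) :=
  drawList (acceptable D).card D

/-- Sets of lists are all measurable. -/
instance listMeasurableSpace {α : Type*} : MeasurableSpace (List α) := ⊤

/-- The law of all preference lists when everyone has popularity preferences (man `m` with
popularities `DM m`, woman `w` with popularities `DW w`) and the lists of different persons are
independent. -/
noncomputable def profileLaw {M W : Type*} [Fintype M] [Fintype W]
    (DM : M → W → ℝ≥0) (DW : W → M → ℝ≥0) :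
    MeasureTheory.Measure ((M → List W) × (W → List M)) :=
  (MeasureTheory.Measure.pi fun m => (popularityList (DM m)).toMeasure).prod
    (MeasureTheory.Measure.pi fun w => (popularityList (DW w)).toMeasure)

/-- The expected number of stable pairs. -/
noncomputable def expectedStablePairs {M W : Type*} [Fintype M] [Fintype W]
    [DecidableEq M] [DecidableEq W] (DM : M → W → ℝ≥0) (DW : W → M → ℝ≥0) : ℝ :=
  ∫ x, ((stablePairs x.1 x.2).ncard : ℝ) ∂(profileLaw DM DW)

end StableMarriage

/-! Fix a receiver `y₀` and the lists of everybody else. Let `f S` be the set of proposers who reach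
`y₀` when she rejects exactly `S` and the others run deferred acceptance (`proposers`). This `f` is
monotone and does not see the order of her list (`proposers_congr`). Let `B = leastClosed f` be the
proposers obtained when she rejects everybody, and `F` the final proposers when she follows her
list. Her best stable partner is her favourite in `B`, her worst one her favourite in `F`
(`favorite_eq_optimal`). Every stable partner is her favourite in some term of the increasing chain
`F ⊆ f F ⊆ f (f F) ⊆ ...`, which ends at `B` (`exists_favorite_iterate`).

Now draw her list at random. Whether the final set is `F` depends only on the order inside `F`
(`finalProposers_eq_iff`), and given this order a newcomer `x` is the favourite in a larger set `G`
with probability `D x / D(G)` (`popExp_filter_mul_favorite`). The expected number of changes of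
favourite is therefore at most a telescoping sum bounded by `log D(B) - log D(F)`. The entropy
inequality `log_sub_log_le`, with `F` lumped into one outcome among at most `K`, turns this into the
expectation of `log K + log D(best) - log D(worst)`; hence `popExp_card_le`, where `K = min(d,
number of receivers)`.

Add these bounds over all women and all men, which counts each stable pair twice. The best partners
on one side and the worst on the other come from the same optimal matching, so the logarithms
regroup into ratios of the two popularities of matched pairs. Each ratio costs at most `log r`, and
each of the two optimal matchings has at most `N` pairs (`sum_gain_add_sum_gain_le`). Bounding `K`
by `d` gives the first estimate; bounding it by `N` when `r = 1` gives the second. -/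

namespace StableMarriage

/-! ### Deferred acceptance

Proposers `X` and receivers `Y`; `A x y` says that `x` and `y` accept each other, `p x` and `q y` are
the ranks in their preferences (smaller is better). -/

section DeferredAcceptance

variable {X Y : Type*} {A : X → Y → Prop} {p : X → Y → ℕ} {q : Y → X → ℕ}

/-- A matching, given as a relation, which is stable. -/
structure StableRel (A : X → Y → Prop) (p : X → Y → ℕ) (q : Y → X → ℕ) (E : X → Y → Prop) :
    Prop where
  acc : ∀ {x y}, E x y → A x y
  left : ∀ {x y y'}, E x y → E x y' → y = y'
  right : ∀ {x x' y}, E x y → E x' y → x = x'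
  not_blocking : ∀ {x y}, A x y →
    (∃ y', E x y' ∧ p x y' ≤ p x y) ∨ ∃ x', E x' y ∧ q y x' ≤ q y x

/-- When the pairs in `R` have been rejected, `x` has proposed to `y`. -/
def Reaches (A : X → Y → Prop) (p : X → Y → ℕ) (R : X → Y → Prop) (x : X) (y : Y) : Prop :=
  A x y ∧ ∀ y', A x y' → p x y' < p x y → R x y'

theorem Reaches.mono {R R' : X → Y → Prop} (h : ∀ x y, R x y → R' x y) {x : X} {y : Y}
    (hx : Reaches A p R x y) : Reaches A p R' x y :=
  ⟨hx.1, fun y' h1 h2 => h _ _ (hx.2 y' h1 h2)⟩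

/-- The rejections of deferred acceptance, where only the receivers in `act` compare their
proposers, and where the rejections in `base` are imposed. -/
inductive Rejects (A : X → Y → Prop) (p : X → Y → ℕ) (q : Y → X → ℕ) (act : Y → Prop)
    (base : X → Y → Prop) : X → Y → Prop
  | imposed {x : X} {y : Y} : base x y → Rejects A p q act base x y
  | compare {x x' : X} {y : Y} : act y →
      A x y → (∀ y', A x y' → p x y' < p x y → Rejects A p q act base x y') →
      A x' y → (∀ y', A x' y' → p x' y' < p x' y → Rejects A p q act base x' y') →
      q y x' < q y x → Rejects A p q act base x y

theorem Rejects.of_reaches {act : Y → Prop} {base : X → Y → Prop} {x x' : X} {y : Y} (hy : act y)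
    (hx : Reaches A p (Rejects A p q act base) x y)
    (hx' : Reaches A p (Rejects A p q act base) x' y) (h : q y x' < q y x) :
    Rejects A p q act base x y :=
  .compare hy hx.1 hx.2 hx'.1 hx'.2 h

theorem Rejects.imposed_or {act : Y → Prop} {base : X → Y → Prop} {x : X} {y : Y}
    (h : Rejects A p q act base x y) :
    base x y ∨ act y ∧ Reaches A p (Rejects A p q act base) x y ∧
      ∃ x', Reaches A p (Rejects A p q act base) x' y ∧ q y x' < q y x := by
  cases h with
  | imposed h => exact .inl h
  | compare hy h1 h2 h3 h4 h5 => exact .inr ⟨hy, ⟨h1, h2⟩, _, ⟨h3, h4⟩, h5⟩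

theorem Rejects.mono {act : Y → Prop} {base base' : X → Y → Prop} {q' : Y → X → ℕ}
    (hb : ∀ x y, base x y → base' x y) (hq : ∀ y, act y → q y = q' y) {x : X} {y : Y}
    (h : Rejects A p q act base x y) : Rejects A p q' act base' x y := by
  induction h with
  | imposed h => exact .imposed (hb _ _ h)
  | compare hy h1 _ h3 _ h5 ih ih' =>
    exact .compare hy h1 ih h3 ih' (by rw [← hq _ hy]; exact h5)

/-- A proposer who is not rejected by `y` has a current proposal, which is at least as good. -/
theorem exists_current {R : X → Y → Prop} {x : X} {y : Y} (hA : A x y) (hR : ¬ R x y) :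
    ∃ y', Reaches A p R x y' ∧ ¬ R x y' ∧ p x y' ≤ p x y := by
  induction hn : p x y using Nat.strong_induction_on generalizing y with
  | _ n ih =>
    by_cases h : ∀ y', A x y' → p x y' < p x y → R x y'
    · exact ⟨y, ⟨hA, h⟩, hR, hn.le⟩
    · push Not at h
      obtain ⟨y', h1, h2, h3⟩ := h
      obtain ⟨z, hz, hz', hz''⟩ := ih _ (hn ▸ h2) h1 h3 rfl
      exact ⟨z, hz, hz', by omega⟩

/-- Two different acceptable partners have different ranks. -/
def StrictRank {X Y : Type*} (A : X → Y → Prop) (p : X → Y → ℕ) : Prop :=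
  ∀ ⦃x y y'⦄, A x y → A x y' → p x y = p x y' → y = y'

variable (hp : StrictRank A p) (hq : StrictRank (fun y x => A x y) q)

include hp in
theorem current_left_unique {R : X → Y → Prop} {x : X} {y y' : Y} (h : Reaches A p R x y)
    (hR : ¬ R x y) (h' : Reaches A p R x y') (hR' : ¬ R x y') : y = y' := by
  rcases lt_trichotomy (p x y) (p x y') with hlt | heq | hlt
  · exact absurd (h'.2 _ h.1 hlt) hR
  · exact hp h.1 h'.1 heq
  · exact absurd (h.2 _ h'.1 hlt) hR'

include hq in
theorem current_right_unique {R : X → Y → Prop} {x x' : X} {y : Y}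
    (hcl : ∀ {x x'}, Reaches A p R x y → Reaches A p R x' y → q y x' < q y x → R x y)
    (h : Reaches A p R x y) (hR : ¬ R x y) (h' : Reaches A p R x' y) (hR' : ¬ R x' y) :
    x = x' := by
  rcases lt_trichotomy (q y x) (q y x') with hlt | heq | hlt
  · exact absurd (hcl h' h hlt) hR'
  · exact hq h.1 h'.1 heq
  · exact absurd (hcl h h' hlt) hR

include hp hq in
/-- When the rejections are closed under comparison and all justified, the current proposals form
a stable matching. -/
theorem stableRel_current {R : X → Y → Prop}
    (hcl : ∀ {x x' y}, Reaches A p R x y → Reaches A p R x' y → q y x' < q y x → R x y)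
    (hju : ∀ {x y}, R x y → ∃ x', Reaches A p R x' y ∧ q y x' < q y x) :
    StableRel A p q (fun x y => Reaches A p R x y ∧ ¬ R x y) where
  acc h := h.1.1
  left h h' := current_left_unique hp h.1 h.2 h'.1 h'.2
  right h h' := current_right_unique hq hcl h.1 h.2 h'.1 h'.2
  not_blocking {x y} hA := by
    by_cases hR : R x y
    · right
      obtain ⟨x', hx', hlt⟩ := hju hR
      -- Every rejection is caused by a better proposer, so descending along ranks reaches a
      -- proposer whom `y` still holds.
      suffices ∀ n x', q y x' = n → Reaches A p R x' y →
          ∃ z, (Reaches A p R z y ∧ ¬ R z y) ∧ q y z ≤ q y x' by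
        obtain ⟨z, hz, hz'⟩ := this _ x' rfl hx'
        exact ⟨z, hz, hz'.trans hlt.le⟩
      intro n
      induction n using Nat.strong_induction_on with
      | _ n ih =>
        intro x' hn hx'
        by_cases hR' : R x' y
        · obtain ⟨x'', h1, h2⟩ := hju hR'
          obtain ⟨z, hz, hz'⟩ := ih _ (hn ▸ h2) x'' rfl h1
          exact ⟨z, hz, hz'.trans h2.le⟩
        · exact ⟨x', ⟨hx', hR'⟩, le_rfl⟩
    · left
      obtain ⟨y', h1, h2, h3⟩ := exists_current (p := p) hA hR
      exact ⟨y', ⟨h1, h2⟩, h3⟩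

include hp in
/-- Deferred acceptance does not reject the pairs of a stable matching, unless imposed. -/
theorem Rejects.not_stable {E : X → Y → Prop} (hE : StableRel A p q E) {act : Y → Prop}
    {base : X → Y → Prop} (hb : ∀ x y, base x y → ¬ E x y) {x : X} {y : Y}
    (h : Rejects A p q act base x y) : ¬ E x y := by
  induction h with
  | imposed h => exact hb _ _ h
  | @compare x x' y hy h1 _ h3 _ h5 ih ih' =>
    intro hxy
    -- Stability is tested at `x'`, who is preferred to `x`. If `x'` had a strictly better partner
    -- in `E`, that pair would have been rejected earlier.
    rcases hE.not_blocking h3 with ⟨y', h6, h7⟩ | ⟨x'', h6, h7⟩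
    · rcases h7.lt_or_eq with h7 | h7
      · exact ih' _ (hE.acc h6) h7 h6
      · obtain rfl := hp (hE.acc h6) h3 h7
        obtain rfl := hE.right h6 hxy
        exact lt_irrefl _ h5
    · obtain rfl := hE.right h6 hxy
      omega

include hp in
/-- If the relation `C` gives, injectively, to all proposers matched in a stable matching a receiver
that they like at least as much, then it serves all receivers that are matched. -/
theorem StableRel.exists_of_improving [Finite X] {E C : X → Y → Prop} (hE : StableRel A p q E)
    (hCA : ∀ {x y}, C x y → A x y) (hC : ∀ {x x' y}, C x y → C x' y → x = x')
    (himp : ∀ {x y}, E x y → ∃ y', C x y' ∧ p x y' ≤ p x y) {x : X} {y : Y} (hxy : E x y) :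
    ∃ x', C x' y := by
  -- Send a matched proposer to the `E`-partner of the receiver that `C` gives him. This self-map of
  -- a finite set is injective, hence surjective, so every `E`-matched receiver is served by `C`.
  have hstep : ∀ x : {x // ∃ y, E x y}, ∃ z : {x // ∃ y, E x y}, ∃ y, C x.1 y ∧ E z.1 y := by
    rintro ⟨x, y, hxy⟩
    obtain ⟨y', h1, h2⟩ := himp hxy
    rcases hE.not_blocking (hCA h1) with ⟨y'', h3, h4⟩ | ⟨x', h3, _⟩
    · obtain rfl := hE.left hxy h3
      obtain rfl := hp (hCA h1) (hE.acc hxy) (le_antisymm h2 h4)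
      exact ⟨⟨x, _, h3⟩, _, h1, h3⟩
    · exact ⟨⟨x', _, h3⟩, _, h1, h3⟩
  choose f g hf hf' using hstep
  have hinj : Function.Injective f := by
    intro a b hab
    have h := hf' a
    rw [hab] at h
    have hg := hE.left h (hf' b)
    have h1 := hf a
    rw [hg] at h1
    exact Subtype.ext (hC h1 (hf b))
  obtain ⟨a, ha⟩ := (Finite.injective_iff_surjective.1 hinj) ⟨x, y, hxy⟩
  have h := hf' a
  rw [ha] at h
  obtain rfl := hE.left hxy h
  exact ⟨_, hf a⟩

include hp hq in
/-- There is a stable matching which gives to all proposers their best stable partner. -/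
theorem exists_optimal : ∃ E, StableRel A p q E ∧ ∀ E', StableRel A p q E' → ∀ {x y}, E' x y →
    ∃ y', E x y' ∧ p x y' ≤ p x y := by
  refine ⟨_, stableRel_current hp hq
    (R := Rejects A p q (fun _ => True) (fun _ _ => False))
    (fun h h' hlt => .of_reaches trivial h h' hlt) (fun h => ?_), fun E' hE' x y hxy => ?_⟩
  · rcases h.imposed_or with h | ⟨_, _, h⟩
    · exact h.elim
    · exact h
  · obtain ⟨y', h1, h2, h3⟩ := exists_current (p := p) (hE'.acc hxy)
      (fun h => Rejects.not_stable hp hE' (base := fun _ _ => False) (fun _ _ h => h.elim) h hxy)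
    exact ⟨y', ⟨h1, h2⟩, h3⟩

/-! ### The proposers of one receiver -/

/-- The proposers that propose to `y₀` when `y₀` rejects exactly the proposers in `S`, the others
following deferred acceptance. -/
noncomputable def proposers [Fintype X] (A : X → Y → Prop) (p : X → Y → ℕ) (q : Y → X → ℕ)
    (y₀ : Y) (S : Finset X) : Finset X :=
  open Classical in
  {x | Reaches A p (Rejects A p q (· ≠ y₀) (fun x y => x ∈ S ∧ y = y₀)) x y₀}

variable [Fintype X] {y₀ : Y} {S : Finset X}

theorem mem_proposers {x : X} : x ∈ proposers A p q y₀ S ↔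
    Reaches A p (Rejects A p q (· ≠ y₀) (fun x y => x ∈ S ∧ y = y₀)) x y₀ := by
  simp [proposers]

theorem proposers_mono : Monotone (proposers A p q y₀) := by
  intro S S' h x hx
  rw [mem_proposers] at hx ⊢
  exact hx.mono fun x y hxy => hxy.mono (fun _ _ hb => ⟨h hb.1, hb.2⟩) fun _ _ => rfl

/-- Only receivers other than `y₀` ever compare proposers. This is what allows the list of `y₀` to
be drawn after the operator `proposers` is fixed. -/
theorem proposers_congr {q' : Y → X → ℕ} (h : ∀ y, y ≠ y₀ → q y = q' y) :
    proposers A p q y₀ = proposers A p q' y₀ := by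
  funext S
  ext x
  rw [mem_proposers, mem_proposers]
  exact ⟨fun hx => hx.mono fun x y hxy => hxy.mono (fun _ _ hb => hb) h,
    fun hx => hx.mono fun x y hxy => hxy.mono (fun _ _ hb => hb) fun y hy => (h y hy).symm⟩

theorem acc_of_mem_proposers {x : X} (h : x ∈ proposers A p q y₀ S) : A x y₀ :=
  (mem_proposers.1 h).1

omit [Fintype X] in
theorem rejects_iff_mem {x : X} :
    Rejects A p q (· ≠ y₀) (fun x y => x ∈ S ∧ y = y₀) x y₀ ↔ x ∈ S := by
  constructor
  · intro h
    rcases h.imposed_or with h | h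
    · exact h.1
    · exact absurd rfl h.1
  · exact fun h => .imposed ⟨h, rfl⟩

include hp hq in
/-- If `y₀` rejects all proposers but the best one, this one is a stable partner. -/
theorem exists_stable_of_proposers {h : X} (hh : h ∈ proposers A p q y₀ S) (hS : h ∉ S)
    (hS' : ∀ x ∈ S, q y₀ h < q y₀ x) (hmem : ∀ x ∈ proposers A p q y₀ S, x ≠ h → x ∈ S) :
    ∃ E, StableRel A p q E ∧ E h y₀ := by
  classical
  refine ⟨_, stableRel_current hp hq
    (R := Rejects A p q (· ≠ y₀) (fun x y => x ∈ S ∧ y = y₀)) ?_ ?_,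
    mem_proposers.1 hh, fun hr => hS (rejects_iff_mem.1 hr)⟩
  · intro x x' y hx hx' hlt
    by_cases hy : y = y₀
    · subst hy
      refine rejects_iff_mem.2 (hmem x (mem_proposers.2 hx) ?_)
      rintro rfl
      by_cases hx'h : x' = x
      · subst hx'h; omega
      · have := hS' x' (hmem x' (mem_proposers.2 hx') hx'h)
        omega
    · exact .of_reaches hy hx hx' hlt
  · intro x y hr
    rcases hr.imposed_or with ⟨h1, rfl⟩ | ⟨_, _, h1⟩
    · exact ⟨h, mem_proposers.1 hh, hS' x h1⟩
    · exact h1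

include hp in
/-- As long as `y₀` rejects only proposers other than the stable partner `h`, all proposals to `y₀`
are no better than `h`. -/
theorem StableRel.le_of_mem_proposers {E : X → Y → Prop} (hE : StableRel A p q E) {h : X}
    (hh : E h y₀) (hS : h ∉ S) {x : X} (hx : x ∈ proposers A p q y₀ S) : q y₀ h ≤ q y₀ x := by
  obtain ⟨h1, h2⟩ := mem_proposers.1 hx
  rcases hE.not_blocking h1 with ⟨y', h3, h4⟩ | ⟨x', h3, h4⟩
  · rcases h4.lt_or_eq with h4 | h4
    · refine absurd h3 (Rejects.not_stable hp hE ?_ (h2 _ (hE.acc h3) h4))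
      rintro x y ⟨hxS, rfl⟩ hxy
      exact hS (hE.right hh hxy ▸ hxS)
    · obtain rfl := hp (hE.acc h3) h1 h4
      rw [hE.right hh h3]
  · rw [hE.right hh h3]; exact h4

-- If `h` were outside `S`, no pair of `E` would be rejected, so the current proposals would improve
-- on `E` for all matched proposers. They would then serve `y₀` as well, although she rejects
-- everyone who reaches her.
include hp hq in
theorem StableRel.mem_of_proposers_subset {E : X → Y → Prop} (hE : StableRel A p q E) {h : X}
    (hh : E h y₀) (hS : proposers A p q y₀ S ⊆ S) : h ∈ S := by
  by_contra hhS
  have hb : ∀ x y, x ∈ S ∧ y = y₀ → ¬ E x y := by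
    rintro x y ⟨hxS, rfl⟩ hxy
    exact hhS (hE.right hh hxy ▸ hxS)
  obtain ⟨x, h1, h2⟩ := hE.exists_of_improving hp
    (C := fun x y => Reaches A p (Rejects A p q (· ≠ y₀) (fun x y => x ∈ S ∧ y = y₀)) x y ∧
      ¬ Rejects A p q (· ≠ y₀) (fun x y => x ∈ S ∧ y = y₀) x y)
    (fun h => h.1.1) (fun {x x' y} h h' => by
      by_cases hy : y = y₀
      · subst hy
        exact absurd (rejects_iff_mem.2 (hS (mem_proposers.2 h.1))) h.2
      · exact current_right_unique hq (fun h h' hlt => .of_reaches hy h h' hlt)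
          h.1 h.2 h'.1 h'.2)
    (fun {x y} hxy => by
      obtain ⟨y', h1, h2, h3⟩ := exists_current (p := p) (hE.acc hxy)
        (fun hr => Rejects.not_stable hp hE hb hr hxy)
      exact ⟨y', ⟨h1, h2⟩, h3⟩) hh
  exact h2 (rejects_iff_mem.2 (hS (mem_proposers.2 h1)))

include hq in
/-- Those who do not propose to `y₀` are held by other receivers. -/
theorem card_sdiff_proposers_lt [Fintype Y] [DecidableEq X] {B : Finset X}
    (hB : ∀ x ∈ B, A x y₀) : (B \ proposers A p q y₀ S).card < Fintype.card Y := by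
  classical
  -- Someone who accepts `y₀` but has not reached her is held by a receiver he strictly prefers, and
  -- distinct such proposers are held by distinct receivers.
  have hcur : ∀ x ∈ B \ proposers A p q y₀ S, ∃ y, y ≠ y₀ ∧
      Reaches A p (Rejects A p q (· ≠ y₀) (fun x y => x ∈ S ∧ y = y₀)) x y ∧
      ¬ Rejects A p q (· ≠ y₀) (fun x y => x ∈ S ∧ y = y₀) x y := by
    intro x hx
    rw [Finset.mem_sdiff, mem_proposers, Reaches] at hx
    obtain ⟨hxB, hx⟩ := hx
    push Not at hx
    obtain ⟨y, h1, h2, h3⟩ := hx (hB x hxB)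
    obtain ⟨y', h4, h5, h6⟩ := exists_current (p := p) h1 h3
    refine ⟨y', ?_, h4, h5⟩
    rintro rfl
    omega
  have : Nonempty Y := ⟨y₀⟩
  choose! f hf using hcur
  have hle : (B \ proposers A p q y₀ S).card ≤ (Finset.univ.erase y₀).card :=
    Finset.card_le_card_of_injOn f (fun x hx => by simpa using (hf x hx).1) (by
      intro x hx x' hx' hxx
      have h1 := hf x hx
      have h2 := hf x' hx'
      rw [← hxx] at h2
      exact current_right_unique hq (fun h h' hlt => .of_reaches h1.1 h h' hlt)
        h1.2.1 h1.2.2 h2.2.1 h2.2.2)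
  rw [Finset.card_erase_of_mem (Finset.mem_univ _), Finset.card_univ] at hle
  have : 0 < Fintype.card Y := Fintype.card_pos_iff.2 ⟨y₀⟩
  omega

end DeferredAcceptance

/-! ### Favourites in a preference list -/

section Favorite

variable {α : Type*} [DecidableEq α]

/-- The first element of `l` that lies in `F`. -/
def favorite (l : List α) (F : Finset α) : Option α := (l.filter (· ∈ F)).head?

variable {l l' : List α} {F G : Finset α} {x x' : α}

theorem mem_of_favorite (h : favorite l F = some x) : x ∈ F ∧ x ∈ l := by
  have := List.mem_of_mem_head? h
  simpa [and_comm] using this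

theorem exists_favorite (hF : x ∈ F) (hl : x ∈ l) : ∃ z, favorite l F = some z := by
  have h : l.filter (· ∈ F) ≠ [] := List.ne_nil_of_mem (a := x) (by simp [hF, hl])
  exact ⟨_, List.head?_eq_some_head h⟩

theorem idxOf_favorite_le (h : favorite l F = some x) (hF : x' ∈ F) :
    l.idxOf x ≤ l.idxOf x' := by
  induction l with
  | nil => simp [favorite] at h
  | cons a l ih =>
    by_cases ha : a ∈ F
    · simp only [favorite, List.filter_cons, ha, decide_true, if_true, List.head?_cons,
        Option.some.injEq] at h
      subst h
      simp
    · have h' : favorite l F = some x := by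
        simpa [favorite, List.filter_cons, ha] using h
      have hx := (mem_of_favorite h').1
      rw [List.idxOf_cons_ne _ (by rintro rfl; exact ha hx),
        List.idxOf_cons_ne _ (by rintro rfl; exact ha hF)]
      exact Nat.succ_le_succ (ih h')

theorem favorite_eq_some (hF : x ∈ F) (hl : x ∈ l)
    (h : ∀ x' ∈ F, l.idxOf x ≤ l.idxOf x') : favorite l F = some x := by
  obtain ⟨z, hz⟩ := exists_favorite hF hl
  rw [hz, (List.idxOf_inj hl).1 (le_antisymm (h z (mem_of_favorite hz).1)
    (idxOf_favorite_le hz hF))]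

theorem favorite_of_subset (hFG : F ⊆ G) (h : favorite l G = some x) (hx : x ∈ F) :
    favorite l F = some x :=
  favorite_eq_some hx (mem_of_favorite h).2 fun _ hx' => idxOf_favorite_le h (hFG hx')

theorem filter_filter_of_subset (hFG : F ⊆ G) :
    (l.filter (· ∈ G)).filter (· ∈ F) = l.filter (· ∈ F) := by
  rw [List.filter_filter]
  refine List.filter_congr fun x _ => ?_
  by_cases hx : x ∈ F
  · simp [hx, hFG hx]
  · simp [hx]

theorem filter_congr_of_subset (hFG : F ⊆ G)
    (h : l.filter (· ∈ G) = l'.filter (· ∈ G)) : l.filter (· ∈ F) = l'.filter (· ∈ F) := by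
  rw [← filter_filter_of_subset hFG, h, filter_filter_of_subset hFG]

/-- All elements but the favourite. -/
def rejected (l : List α) (F : Finset α) : Finset α := {x ∈ F | favorite l F ≠ some x}

theorem rejected_subset : rejected l F ⊆ F := Finset.filter_subset _ _

/-- A favourite of the larger set that lies in the smaller one is already the favourite there, so
additional competitors never undo a rejection. -/
theorem rejected_mono : Monotone (rejected l) := by
  intro F G hFG x hx
  rw [rejected, Finset.mem_filter] at hx ⊢
  exact ⟨hFG hx.1, fun h => hx.2 (favorite_of_subset hFG h hx.1)⟩

theorem rejected_congr (h : l.filter (· ∈ F) = l'.filter (· ∈ F)) :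
    rejected l F = rejected l' F := by
  rw [rejected, rejected, favorite, favorite, h]

end Favorite

/-! ### Monotone operators on finite sets -/

section LeastClosed

variable {α : Type*} [Fintype α]

/-- The least set `S` with `f S ⊆ S`. -/
noncomputable def leastClosed (f : Finset α → Finset α) : Finset α :=
  open Classical in {x | ∀ S, f S ⊆ S → x ∈ S}

variable {f : Finset α → Finset α}

theorem leastClosed_subset {S : Finset α} (h : f S ⊆ S) : leastClosed f ⊆ S := by
  intro x hx
  simp only [leastClosed, Finset.mem_filter, Finset.mem_univ, true_and] at hx
  exact hx S h

theorem leastClosed_eq (hf : Monotone f) : f (leastClosed f) = leastClosed f := by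
  have h : f (leastClosed f) ⊆ leastClosed f := by
    intro x hx
    simp only [leastClosed, Finset.mem_filter, Finset.mem_univ, true_and]
    exact fun S hS => hS (hf (leastClosed_subset hS) hx)
  exact h.antisymm (leastClosed_subset (hf h))

theorem exists_iterate_eq {S : Finset α} (hf : Monotone f) (hS : S ⊆ f S) :
    ∃ n, f (f^[n] S) = f^[n] S := by
  by_contra! hne
  have hsub : ∀ n, f^[n] S ⊆ f (f^[n] S) := by
    intro n
    rw [← Function.iterate_succ_apply' f n, Function.iterate_succ_apply]
    exact hf.iterate n hS
  have hcard : ∀ n, n ≤ (f^[n] S).card := by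
    intro n
    induction n with
    | zero => exact Nat.zero_le _
    | succ n ih =>
      rw [Function.iterate_succ_apply']
      exact ih.trans_lt (Finset.card_lt_card ((hsub n).ssubset_of_ne (hne n).symm))
  -- A chain that never stabilises gains an element at each step, so one step more than the size of
  -- the type is impossible.
  have h1 := hcard (Fintype.card α + 1)
  have h2 := Finset.card_le_univ (f^[Fintype.card α + 1] S)
  omega

theorem iterate_subset_leastClosed {S : Finset α} (hf : Monotone f) (hS : S ⊆ leastClosed f)
    (n : ℕ) : f^[n] S ⊆ leastClosed f := by
  induction n with
  | zero => exact hS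
  | succ n ih =>
    rw [Function.iterate_succ_apply', ← leastClosed_eq hf]
    exact hf ih

theorem exists_iterate_eq_leastClosed {S : Finset α} (hf : Monotone f) (hS : S ⊆ f S)
    (hS' : S ⊆ leastClosed f) : ∃ n, f^[n] S = leastClosed f := by
  obtain ⟨n, hn⟩ := exists_iterate_eq hf hS
  exact ⟨n, (iterate_subset_leastClosed hf hS' n).antisymm (leastClosed_subset hn.subset)⟩

variable [DecidableEq α]

/-- The set of proposers rejected at the end of deferred acceptance, for the list `l`. -/
noncomputable def finalRejected (f : Finset α → Finset α) (l : List α) : Finset α :=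
  leastClosed fun S => rejected l (f S)

/-- The set of proposers at the end of deferred acceptance, for the list `l`. -/
noncomputable def finalProposers (f : Finset α → Finset α) (l : List α) : Finset α :=
  f (finalRejected f l)

variable {l l' : List α}

theorem rejected_finalProposers (hf : Monotone f) :
    rejected l (finalProposers f l) = finalRejected f l :=
  leastClosed_eq (f := fun S => rejected l (f S)) (rejected_mono.comp hf)

theorem finalRejected_subset_finalProposers (hf : Monotone f) :
    finalRejected f l ⊆ finalProposers f l := by
  rw [← rejected_finalProposers hf]
  exact rejected_subset

/-- Rejecting the last held proposer too can only bring more proposals; this starts the increasing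
chain of iterates. -/
theorem finalProposers_subset (hf : Monotone f) : finalProposers f l ⊆ f (finalProposers f l) :=
  hf (finalRejected_subset_finalProposers hf)

theorem finalProposers_subset_leastClosed (hf : Monotone f) :
    finalProposers f l ⊆ leastClosed f := by
  rw [← leastClosed_eq hf]
  refine hf (leastClosed_subset ?_)
  rw [leastClosed_eq hf]
  exact rejected_subset

/-- The final rejections for `l` are also closed for `l'`, because rejecting within the final set
uses only the order of its elements. -/
theorem finalProposers_subset_of_filter_eq (hf : Monotone f)
    (h : l.filter (· ∈ finalProposers f l) = l'.filter (· ∈ finalProposers f l)) :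
    finalProposers f l' ⊆ finalProposers f l := by
  refine hf (leastClosed_subset ?_)
  rw [show f (finalRejected f l) = finalProposers f l from rfl, ← rejected_congr h,
    rejected_finalProposers hf]

/-- The final set of proposers depends only on the order of these proposers. -/
theorem finalProposers_congr (hf : Monotone f)
    (h : l.filter (· ∈ finalProposers f l) = l'.filter (· ∈ finalProposers f l)) :
    finalProposers f l' = finalProposers f l := by
  have h1 := finalProposers_subset_of_filter_eq hf h
  exact h1.antisymm
    (finalProposers_subset_of_filter_eq hf (filter_congr_of_subset h1 h).symm)

/-- This expresses the event "the final set is `F`" through the order of `F` alone, so that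
conditioning on it leaves the comparison with later proposers random. -/
theorem finalProposers_eq_iff (hf : Monotone f) (F : Finset α) :
    finalProposers f (l.filter (· ∈ F)) = F ↔ finalProposers f l = F := by
  have hl : (l.filter (· ∈ F)).filter (· ∈ F) = l.filter (· ∈ F) :=
    filter_filter_of_subset subset_rfl
  constructor
  · intro h
    rw [finalProposers_congr (l := l.filter (· ∈ F)) hf (by rw [h, hl]), h]
  · intro h
    rw [finalProposers_congr (l := l) hf (by rw [h, hl]), h]

/-- With no final proposers nobody was rejected, so `f ∅ = ∅`. Thus being single does not depend on
the list `l`. -/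
theorem finalProposers_eq_empty_iff (hf : Monotone f) :
    finalProposers f l = ∅ ↔ leastClosed f = ∅ := by
  constructor
  · intro h
    have h1 := finalRejected_subset_finalProposers (l := l) hf
    rw [h, Finset.subset_empty] at h1
    rw [finalProposers, h1] at h
    exact Finset.subset_empty.1 (leastClosed_subset h.subset)
  · intro h
    exact Finset.subset_empty.1 (h ▸ finalProposers_subset_leastClosed (l := l) hf)

/-- A person who is not worse than all proposers as long as he is not rejected, is the favourite at
some time when rejections go on. -/
theorem exists_favorite_iterate {h : α} (hl : h ∈ l)
    (hle : ∀ S, h ∉ S → ∀ x ∈ f S, l.idxOf h ≤ l.idxOf x) {n : ℕ}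
    (hn : h ∈ f^[n] (finalProposers f l)) :
    ∃ k ≤ n, favorite l (f^[k] (finalProposers f l)) = some h := by
  classical
  have hex : ∃ k, h ∈ f^[k] (finalProposers f l) := ⟨n, hn⟩
  refine ⟨Nat.find hex, Nat.find_min' hex hn, favorite_eq_some (Nat.find_spec hex) hl ?_⟩
  -- At the first time `h` appears, the preceding set omits `h`, so the hypothesis makes `h` the
  -- best. At time zero the preceding set is `finalRejected f l`, which omits `h` because the
  -- complement of `h` is closed.
  rcases hk : Nat.find hex with _ | k
  · refine hle _ fun hh => ?_
    have hsub : finalRejected f l ⊆ Finset.univ.erase h := by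
      refine leastClosed_subset fun x hx => ?_
      rw [Finset.mem_erase]
      refine ⟨?_, Finset.mem_univ _⟩
      rintro rfl
      rw [rejected, Finset.mem_filter] at hx
      exact hx.2 (favorite_eq_some hx.1 hl (hle _ (by simp)))
    simpa using hsub hh
  · rw [Function.iterate_succ_apply']
    exact hle _ (Nat.find_min hex (by omega))

/-- The number of values of a sequence is at most one more than the number of changes. -/
theorem card_image_range_le {β : Type*} [DecidableEq β] (g : ℕ → β) (n : ℕ) :
    ((Finset.range (n + 1)).image g).card ≤
      1 + ∑ k ∈ Finset.range n, if g (k + 1) = g k then 0 else 1 := by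
  induction n with
  | zero => simp
  | succ n ih =>
    rw [Finset.range_add_one, Finset.image_insert, Finset.sum_range_succ]
    split_ifs with h
    · rw [Finset.insert_eq_of_mem]
      · exact ih
      · rw [h]
        exact Finset.mem_image_of_mem g (by simp)
    · exact (Finset.card_insert_le _ _).trans (by omega)

omit [Fintype α] in
/-- A set of persons, each of which is a favourite at some time. -/
theorem card_le_of_favorite_iterate {F H : Finset α} (hf : Monotone f) (hF : F ⊆ f F)
    (hF0 : F.Nonempty) {n : ℕ} (hl : ∀ k ≤ n, ∀ x ∈ f^[k] F, x ∈ l)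
    (hH : ∀ h ∈ H, ∃ k ≤ n, favorite l (f^[k] F) = some h) :
    H.card ≤ 1 + ∑ k ∈ Finset.range n, ∑ x ∈ f^[k + 1] F \ f^[k] F,
      if favorite l (f^[k + 1] F) = some x then 1 else 0 := by
  have hsub : ∀ k, f^[k] F ⊆ f^[k + 1] F := by
    intro k
    rw [Function.iterate_succ_apply]
    exact hf.iterate k hF
  have hne : ∀ k, (f^[k] F).Nonempty := by
    intro k
    induction k with
    | zero => exact hF0
    | succ k ih => exact ih.mono (hsub k)
  calc H.card = (H.image some).card := (Finset.card_image_of_injective _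
        (Option.some_injective α)).symm
    _ ≤ ((Finset.range (n + 1)).image fun k => favorite l (f^[k] F)).card := by
        refine Finset.card_le_card fun o ho => ?_
        obtain ⟨h, hh, rfl⟩ := Finset.mem_image.1 ho
        obtain ⟨k, hk, hk'⟩ := hH h hh
        exact Finset.mem_image.2 ⟨k, by simp; omega, hk'⟩
    _ ≤ _ := card_image_range_le _ n
    _ ≤ _ := by
        refine Nat.add_le_add_left (Finset.sum_le_sum fun k hk => ?_) 1
        rw [Finset.mem_range] at hk
        split_ifs with heq
        · exact Nat.zero_le _
        · obtain ⟨z, hz⟩ := hne (k + 1)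
          obtain ⟨x, hx⟩ := exists_favorite hz (hl (k + 1) (by omega) z hz)
          -- A changed favourite must be a newcomer, since an old element that is best in the larger
          -- set was already best before.
          have hxk : x ∉ f^[k] F := fun hxk => heq
            (by rw [hx, favorite_of_subset (hsub k) hx hxk])
          refine le_trans ?_ (Finset.single_le_sum (fun _ _ => Nat.zero_le _)
            (Finset.mem_sdiff.2 ⟨(mem_of_favorite hx).1, hxk⟩))
          exact (if_pos hx).ge

end LeastClosed

/-! ### Expectations under popularity preferences -/

section Draw

variable {α : Type*} [Fintype α]

open Classical in
/-- The expectation of `φ` under `drawList`. -/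
noncomputable def drawExp : ℕ → (α → ℝ≥0) → (List α → ℝ) → ℝ
  | 0, _, φ => φ []
  | k + 1, D, φ =>
    if D ≠ 0 then
      ∑ a, ((D a : ℝ) / ∑ b, (D b : ℝ)) *
        drawExp k (Function.update D a 0) fun l => φ (a :: l)
    else φ []

/-- The expectation of `φ` under `popularityList`. -/
noncomputable def popExp (D : α → ℝ≥0) (φ : List α → ℝ) : ℝ :=
  drawExp (acceptable D).card D φ

theorem mem_acceptable {D : α → ℝ≥0} {a : α} : a ∈ acceptable D ↔ D a ≠ 0 := by
  simp [acceptable]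

variable {D : α → ℝ≥0}

theorem sum_pos_of_ne_zero (hD : D ≠ 0) : 0 < ∑ b, (D b : ℝ) := by
  obtain ⟨a, ha⟩ := Function.ne_iff.1 hD
  exact Finset.sum_pos' (fun b _ => (D b).2)
    ⟨a, Finset.mem_univ _, lt_of_le_of_ne (D a).2 fun h => ha (NNReal.coe_injective h.symm)⟩

theorem acceptable_update [DecidableEq α] (a : α) :
    acceptable (Function.update D a 0) = (acceptable D).erase a := by
  ext b
  rw [mem_acceptable, Finset.mem_erase, mem_acceptable]
  by_cases h : b = a
  · subst h; simp
  · simp [h]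

theorem popExp_zero (φ : List α → ℝ) : popExp (0 : α → ℝ≥0) φ = φ [] := by
  have : acceptable (0 : α → ℝ≥0) = ∅ := by
    ext b; simp [mem_acceptable]
  rw [popExp, this]
  rfl

theorem popExp_eq [DecidableEq α] (hD : D ≠ 0) (φ : List α → ℝ) :
    popExp D φ = ∑ a, ((D a : ℝ) / ∑ b, (D b : ℝ)) *
      popExp (Function.update D a 0) fun l => φ (a :: l) := by
  obtain ⟨a, ha⟩ := Function.ne_iff.1 hD
  have ha' : a ∈ acceptable D := mem_acceptable.2 ha
  obtain ⟨k, hk⟩ : ∃ k, (acceptable D).card = k + 1 :=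
    Nat.exists_eq_succ_of_ne_zero (Finset.card_ne_zero_of_mem ha')
  rw [popExp, hk, drawExp, if_pos hD]
  refine Finset.sum_congr rfl fun b _ => ?_
  by_cases hb : D b = 0
  · simp [hb]
  · rw [popExp, acceptable_update, Finset.card_erase_of_mem (mem_acceptable.2 hb), hk,
      Nat.add_sub_cancel]
    congr!

/-- The lists of length at most `n`. -/
noncomputable def listsUpTo (α : Type*) [Fintype α] : ℕ → Finset (List α)
  | 0 => {[]}
  | n + 1 => open Classical in
    insert [] ((Finset.univ ×ˢ listsUpTo α n).image fun x : α × List α => x.1 :: x.2)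

theorem sum_listsUpTo_succ (n : ℕ) (f : List α → ℝ) :
    ∑ l ∈ listsUpTo α (n + 1), f l = f [] + ∑ a, ∑ l ∈ listsUpTo α n, f (a :: l) := by
  classical
  rw [listsUpTo, Finset.sum_insert (by simp), Finset.sum_image, Finset.sum_product]
  rintro ⟨a, l⟩ _ ⟨b, l'⟩ _ h
  simpa using h

theorem drawOne_apply (hD : D ≠ 0) (a : α) :
    (drawOne D hD a).toReal = (D a : ℝ) / ∑ b, (D b : ℝ) := by
  rw [drawOne, PMF.normalize_apply, tsum_fintype, ENNReal.toReal_mul, ENNReal.toReal_inv,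
    ENNReal.toReal_sum fun _ _ => ENNReal.coe_ne_top]
  simp [div_eq_mul_inv]

open Classical in
theorem drawList_succ_nil (hD : D ≠ 0) (k : ℕ) : drawList (k + 1) D [] = 0 := by
  rw [drawList, dif_pos hD, PMF.bind_apply]
  simp [PMF.map_apply]

open Classical in
theorem drawList_succ_cons (hD : D ≠ 0) (k : ℕ) (a : α) (l : List α) :
    drawList (k + 1) D (a :: l) = drawOne D hD a * drawList k (Function.update D a 0) l := by
  rw [drawList, dif_pos hD, PMF.bind_apply, tsum_eq_single a]
  · rw [PMF.map_apply, tsum_eq_single l]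
    · simp
    · intro l' hl
      simp [hl.symm]
  · intro b hb
    simp [PMF.map_apply, hb.symm]

/-- The slack in `n` lets one finite set of lists serve for all popularities, which makes linearity
of the expectation immediate. -/
theorem drawExp_eq_sum (k : ℕ) : ∀ (n : ℕ), k ≤ n → ∀ (D : α → ℝ≥0) (φ : List α → ℝ),
    drawExp k D φ = ∑ l ∈ listsUpTo α n, (drawList k D l).toReal * φ l := by
  classical
  have hpure : ∀ (n : ℕ) (φ : List α → ℝ),
      φ [] = ∑ l ∈ listsUpTo α n, ((PMF.pure [] : PMF (List α)) l).toReal * φ l := by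
    intro n φ
    rw [Finset.sum_eq_single []]
    · simp
    · intro l _ hl
      simp [hl]
    · intro h
      cases n <;> simp [listsUpTo] at h
  induction k with
  | zero => exact fun n _ D φ => hpure n φ
  | succ k ih =>
    intro n hn D φ
    by_cases hD : D ≠ 0
    · obtain ⟨n, rfl⟩ : ∃ n', n = n' + 1 := ⟨n - 1, by omega⟩
      rw [sum_listsUpTo_succ, drawList_succ_nil hD, drawExp, if_pos hD]
      simp only [ENNReal.toReal_zero, zero_mul, zero_add]
      refine Finset.sum_congr rfl fun a _ => ?_
      rw [ih n (by omega), Finset.mul_sum]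
      refine Finset.sum_congr rfl fun l _ => ?_
      rw [drawList_succ_cons hD, ENNReal.toReal_mul, drawOne_apply, mul_assoc]
    · rw [drawExp, if_neg hD, drawList, dif_neg hD]
      exact hpure n φ

theorem popExp_eq_sum (D : α → ℝ≥0) (φ : List α → ℝ) :
    popExp D φ =
      ∑ l ∈ listsUpTo α (Fintype.card α), (popularityList D l).toReal * φ l :=
  drawExp_eq_sum _ _ (Finset.card_le_univ _) D φ

/-- The list contains exactly the acceptable partners. -/
theorem mem_iff_of_popularityList_ne_zero (D : α → ℝ≥0) :
    ∀ l, popularityList D l ≠ 0 → ∀ a, a ∈ l ↔ a ∈ acceptable D := by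
  classical
  induction hn : (acceptable D).card generalizing D with
  | zero =>
    intro l hl a
    rw [popularityList, hn, drawList] at hl
    have : l = [] := by
      by_contra h
      simp [h] at hl
    rw [Finset.card_eq_zero] at hn
    simp [this, hn]
  | succ k ih =>
    intro l hl a
    have hD : D ≠ 0 := by
      rintro rfl
      have : acceptable (0 : α → ℝ≥0) = ∅ := by
        ext b; simp [mem_acceptable]
      simp [this] at hn
    rw [popularityList, hn] at hl
    cases l with
    | nil => exact absurd (drawList_succ_nil hD k) hl
    | cons b l =>
      rw [drawList_succ_cons hD] at hl
      have hb : D b ≠ 0 := by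
        intro hb
        apply left_ne_zero_of_mul hl
        rw [drawOne, PMF.normalize_apply, hb]
        simp
      have hcard : (acceptable (Function.update D b 0)).card = k := by
        rw [acceptable_update, Finset.card_erase_of_mem (mem_acceptable.2 hb), hn]
        rfl
      have hl' := right_ne_zero_of_mul hl
      have := ih (Function.update D b 0) hcard l (by
        rw [popularityList, hcard]
        convert hl') a
      rw [List.mem_cons, this, acceptable_update, Finset.mem_erase]
      by_cases hab : a = b
      · simp [hab, mem_acceptable, hb]
      · simp [hab]

/-- Induction on the number of acceptable partners. -/
theorem pop_induction [DecidableEq α] {motive : (α → ℝ≥0) → Prop} (zero : motive 0)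
    (step : ∀ D, D ≠ 0 → (∀ a, D a ≠ 0 → motive (Function.update D a 0)) → motive D)
    (D : α → ℝ≥0) : motive D := by
  induction hn : (acceptable D).card using Nat.strong_induction_on generalizing D with
  | _ n ih =>
    by_cases hD : D = 0
    · exact hD ▸ zero
    · refine step D hD fun a ha => ih _ ?_ _ rfl
      rw [acceptable_update, ← hn]
      exact Finset.card_erase_lt_of_mem (mem_acceptable.2 ha)

variable [DecidableEq α]

/-- The popularities restricted to `F`. -/
noncomputable def restrictTo (D : α → ℝ≥0) (F : Finset α) : α → ℝ≥0 :=
  fun a => if a ∈ F then D a else 0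

omit [Fintype α] in
theorem restrictTo_update_of_mem {F : Finset α} (a : α) :
    restrictTo (Function.update D a 0) F = Function.update (restrictTo D F) a 0 := by
  funext b
  by_cases h : b = a
  · subst h; simp [restrictTo]
  · simp [restrictTo, h]

omit [Fintype α] in
theorem restrictTo_update_of_notMem {F : Finset α} {a : α} (ha : a ∉ F) :
    restrictTo (Function.update D a 0) F = restrictTo D F := by
  funext b
  by_cases h : b = a
  · subst h; simp [restrictTo, ha]
  · simp [restrictTo, h]

omit [Fintype α] in
theorem restrictTo_restrictTo {F B : Finset α} (hFB : F ⊆ B) :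
    restrictTo (restrictTo D B) F = restrictTo D F := by
  funext b
  by_cases h : b ∈ F
  · simp [restrictTo, h, hFB h]
  · simp [restrictTo, h]

theorem sum_restrictTo (F : Finset α) :
    ∑ b, (restrictTo D F b : ℝ) = ∑ b ∈ F, (D b : ℝ) := by
  simp only [restrictTo, apply_ite NNReal.toReal, NNReal.coe_zero]
  rw [Finset.sum_ite_mem, Finset.univ_inter]

/-- The order of the elements of `F` follows popularity preferences. -/
theorem popExp_filter (F : Finset α) (D : α → ℝ≥0) : ∀ φ : List α → ℝ,
    popExp D (fun l => φ (l.filter (· ∈ F))) = popExp (restrictTo D F) φ := by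
  induction D using pop_induction with
  | zero =>
    intro φ
    have : restrictTo (0 : α → ℝ≥0) F = 0 := by funext b; simp [restrictTo]
    rw [this, popExp_zero, popExp_zero]
    rfl
  | step D hD ih =>
    intro φ
    have hS := sum_pos_of_ne_zero hD
    rw [popExp_eq hD]
    -- A first draw outside `F` leaves the filtered law unchanged; a first draw inside `F` is the
    -- first draw of the restricted popularities.
    have hterm : ∀ a, ((D a : ℝ) / ∑ b, (D b : ℝ)) *
        (popExp (Function.update D a 0) fun l => φ ((a :: l).filter (· ∈ F))) =
        (∑ b, (D b : ℝ))⁻¹ * (if a ∈ F then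
          (D a : ℝ) * popExp (Function.update (restrictTo D F) a 0) (fun l => φ (a :: l))
          else (D a : ℝ) * popExp (restrictTo D F) φ) := by
      intro a
      by_cases ha0 : D a = 0
      · simp [ha0]
      by_cases ha : a ∈ F
      · rw [if_pos ha, ← restrictTo_update_of_mem, ← ih a ha0 fun l => φ (a :: l)]
        simp only [List.filter_cons, ha, decide_true, if_true]
        ring
      · rw [if_neg ha, ← restrictTo_update_of_notMem ha, ← ih a ha0 φ]
        simp only [List.filter_cons, ha, decide_false, Bool.false_eq_true, if_false]
        ring
    have hin : ∑ a ∈ F, (D a : ℝ) *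
        popExp (Function.update (restrictTo D F) a 0) (fun l => φ (a :: l)) =
        (∑ a ∈ F, (D a : ℝ)) * popExp (restrictTo D F) φ := by
      by_cases h0 : restrictTo D F = 0
      · have hz : ∀ a ∈ F, (D a : ℝ) = 0 := by
          intro a ha
          have := congrFun h0 a
          simpa [restrictTo, ha] using this
        rw [Finset.sum_eq_zero hz, zero_mul]
        exact Finset.sum_eq_zero fun a ha => by rw [hz a ha, zero_mul]
      · have hpos := sum_pos_of_ne_zero h0
        rw [popExp_eq h0 φ, ← sum_restrictTo, Finset.mul_sum,
          ← Finset.sum_subset (Finset.subset_univ F)]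
        · refine Finset.sum_congr rfl fun a ha => ?_
          rw [← mul_assoc, mul_div_cancel₀ _ hpos.ne']
          simp [restrictTo, ha]
        · intro a _ ha
          simp [restrictTo, ha]
    rw [Finset.sum_congr rfl fun a _ => hterm a, ← Finset.mul_sum, Finset.sum_ite,
      Finset.filter_mem_eq_inter, Finset.univ_inter, hin, ← Finset.sum_mul, ← add_mul,
      show ∑ a ∈ F, (D a : ℝ) = ∑ a with a ∈ F, (D a : ℝ) by
        rw [Finset.filter_mem_eq_inter, Finset.univ_inter],
      Finset.sum_filter_add_sum_filter_not, inv_mul_cancel_left₀ hS.ne']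

theorem popExp_one : ∀ D : α → ℝ≥0, popExp D (fun _ => 1) = 1 := by
  intro D
  induction D using pop_induction with
  | zero => exact popExp_zero _
  | step D hD ih =>
    have hS := sum_pos_of_ne_zero hD
    rw [popExp_eq hD, Finset.sum_congr rfl (g := fun a => (D a : ℝ) / ∑ b, (D b : ℝ)) fun a _ => ?_,
      ← Finset.sum_div, div_self hS.ne']
    by_cases ha0 : D a = 0
    · simp [ha0]
    · rw [ih a ha0, mul_one]

/-- The favourite in `B` is `x` with probability proportional to `D x`, independently of the order
of a subset of `B` that does not contain `x`. -/
theorem popExp_filter_mul_favorite {F B : Finset α} (hFB : F ⊆ B) {x : α} (hxB : x ∈ B)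
    (hxF : x ∉ F) (φ : List α → ℝ) :
    popExp D (fun l => φ (l.filter (· ∈ F)) * if favorite l B = some x then 1 else 0) =
      (D x / ∑ b ∈ B, (D b : ℝ)) * popExp D (fun l => φ (l.filter (· ∈ F))) := by
  have h1 : (fun l : List α => φ (l.filter (· ∈ F)) * if favorite l B = some x then 1 else 0) =
      fun l => (fun l' : List α => φ (l'.filter (· ∈ F)) * if l'.head? = some x then 1 else 0)
        (l.filter (· ∈ B)) := by
    funext l
    simp only [filter_filter_of_subset hFB]
    rfl
  rw [h1, popExp_filter B D fun l' => φ (l'.filter (· ∈ F)) * if l'.head? = some x then 1 else 0,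
    popExp_filter]
  by_cases h0 : restrictTo D B = 0
  · have hx := congrFun h0 x
    simp only [restrictTo, hxB, if_true, Pi.zero_apply] at hx
    rw [h0, popExp_zero, hx]
    simp
  · rw [popExp_eq h0, Finset.sum_eq_single x]
    · simp only [List.head?_cons, if_true, mul_one, List.filter_cons, hxF, decide_false,
        Bool.false_eq_true, if_false]
      -- Removing `x` does not alter the popularities on `F`, which gives the independence.
      rw [popExp_filter, restrictTo_update_of_notMem hxF, restrictTo_restrictTo hFB,
        sum_restrictTo]
      simp [restrictTo, hxB]
    · intro a _ hax
      have : (fun l : List α => φ ((a :: l).filter (· ∈ F)) *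
          if (a :: l).head? = some x then 1 else 0) = fun _ => 0 := by
        funext l
        simp [hax]
      rw [this, popExp_eq_sum]
      simp
    · simp

end Draw

/-! ### Linearity and monotonicity of the expectation -/

section PopExp

variable {α : Type*} [Fintype α] {D : α → ℝ≥0}

theorem popExp_add (φ ψ : List α → ℝ) :
    popExp D (fun l => φ l + ψ l) = popExp D φ + popExp D ψ := by
  simp only [popExp_eq_sum, mul_add, Finset.sum_add_distrib]

theorem popExp_mul_const (φ : List α → ℝ) (c : ℝ) :
    popExp D (fun l => φ l * c) = popExp D φ * c := by
  simp only [popExp_eq_sum, ← mul_assoc, Finset.sum_mul]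

theorem popExp_sum {ι : Type*} (s : Finset ι) (φ : ι → List α → ℝ) :
    popExp D (fun l => ∑ i ∈ s, φ i l) = ∑ i ∈ s, popExp D (φ i) := by
  simp only [popExp_eq_sum, Finset.mul_sum]
  exact Finset.sum_comm

theorem popExp_mono {φ ψ : List α → ℝ}
    (h : ∀ l, (∀ a, a ∈ l ↔ a ∈ acceptable D) → φ l ≤ ψ l) : popExp D φ ≤ popExp D ψ := by
  rw [popExp_eq_sum, popExp_eq_sum]
  refine Finset.sum_le_sum fun l _ => ?_
  by_cases hl : popularityList D l = 0
  · simp [hl]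
  · exact mul_le_mul_of_nonneg_left (h l (mem_iff_of_popularityList_ne_zero D l hl))
      ENNReal.toReal_nonneg

end PopExp

/-- An entropy bound. -/
theorem log_sub_log_le {α : Type*} (T : Finset α) (d : α → ℝ) (hd : ∀ x ∈ T, 0 < d x) {f b K : ℝ}
    (hf : 0 < f) (hb : b = f + ∑ x ∈ T, d x) (hK : (T.card : ℝ) + 1 ≤ K) :
    Real.log b - Real.log f ≤
      Real.log K + ∑ x ∈ T, d x / b * (Real.log (d x) - Real.log f) := by
  have hb0 : 0 < b := by
    have := Finset.sum_nonneg fun x hx => (hd x hx).le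
    linarith
  have hK0 : 0 < K := (by positivity : (0 : ℝ) < T.card + 1).trans_le hK
  -- This is `log u ≤ u - 1` at the ratio `u = b / (t * K)` of the uniform mass `1 / K` to the mass
  -- `t / b`. It is applied to each `d x` and to `f`, the lumped outcome.
  have key : ∀ t, 0 < t →
      t / b * (Real.log b - Real.log t - Real.log K) ≤ 1 / K - t / b := by
    intro t ht
    have h1 : Real.log b - Real.log t - Real.log K = Real.log (b / (t * K)) := by
      rw [Real.log_div hb0.ne' (by positivity), Real.log_mul ht.ne' hK0.ne']
      ring
    have h2 := Real.log_le_sub_one_of_pos (x := b / (t * K)) (by positivity)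
    calc t / b * (Real.log b - Real.log t - Real.log K) ≤ t / b * (b / (t * K) - 1) := by
          rw [h1]
          exact mul_le_mul_of_nonneg_left h2 (by positivity)
      _ = 1 / K - t / b := by field_simp
  have hsum := Finset.sum_le_sum fun x hx => key (d x) (hd x hx)
  have h1 := key f hf
  have hw : ∑ x ∈ T, d x / b = 1 - f / b := by
    rw [← Finset.sum_div, eq_sub_iff_add_eq, ← add_div, div_eq_one_iff_eq hb0.ne', hb]
    ring
  have hexp : ∑ x ∈ T, d x / b * (Real.log b - Real.log (d x) - Real.log K) =
      (∑ x ∈ T, d x / b) * (Real.log b - Real.log f - Real.log K) -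
        ∑ x ∈ T, d x / b * (Real.log (d x) - Real.log f) := by
    rw [Finset.sum_mul, ← Finset.sum_sub_distrib]
    exact Finset.sum_congr rfl fun x _ => by ring
  rw [hexp, Finset.sum_sub_distrib, hw, Finset.sum_const, nsmul_eq_mul] at hsum
  have h2 : (T.card : ℝ) * (1 / K) + 1 / K ≤ 1 := by
    rw [← add_one_mul, mul_one_div, div_le_one hK0]
    exact hK
  linarith

/-! ### Expected number of successive favourites -/

section Records

variable {α : Type*} [Fintype α] [DecidableEq α]

/-- The logarithm of the popularity of the partner, if any. -/
noncomputable def logPop (D : α → ℝ≥0) (o : Option α) : ℝ := o.elim 0 fun a => Real.log (D a)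

variable {D : α → ℝ≥0} {f : Finset α → Finset α}

/-- With `s k` the total popularity of `f^[k] F`, the favourite in the next set is a newcomer with
probability `1 - s k / s (k + 1)`, whatever the order of `F`. This is at most `log s (k + 1) - log s
k`, and the sum telescopes. The weight `ψ` will be the indicator of the final set. -/
theorem popExp_indicator_mul_records (hf : Monotone f) (hacc : ∀ S, f S ⊆ acceptable D)
    {F : Finset α} (hF : F ⊆ f F) (hFacc : F ⊆ acceptable D) (hF0 : F.Nonempty) (n : ℕ)
    {ψ : List α → ℝ} (hψ : ∀ l, 0 ≤ ψ l) :
    popExp D (fun l => ψ (l.filter (· ∈ F)) * (1 + ∑ k ∈ Finset.range n,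
        ∑ x ∈ f^[k + 1] F \ f^[k] F, if favorite l (f^[k + 1] F) = some x then 1 else 0)) ≤
      popExp D (fun l => ψ (l.filter (· ∈ F))) *
        (1 + (Real.log (∑ x ∈ f^[n] F, (D x : ℝ)) - Real.log (∑ x ∈ F, (D x : ℝ)))) := by
  have hsub : ∀ k, f^[k] F ⊆ f^[k + 1] F := by
    intro k
    rw [Function.iterate_succ_apply]
    exact hf.iterate k hF
  have hsub' : ∀ k, F ⊆ f^[k] F := by
    intro k
    induction k with
    | zero => exact subset_rfl
    | succ k ih => exact ih.trans (hsub k)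
  have hgacc : ∀ k, f^[k] F ⊆ acceptable D := by
    intro k
    cases k with
    | zero => exact hFacc
    | succ k => rw [Function.iterate_succ_apply']; exact hacc _
  have hpos : ∀ k, 0 < ∑ x ∈ f^[k] F, (D x : ℝ) := fun k =>
    Finset.sum_pos (fun x hx => NNReal.coe_pos.2
      (pos_iff_ne_zero.2 (mem_acceptable.1 (hgacc k hx)))) (hF0.mono (hsub' k))
  have hpr : 0 ≤ popExp D fun l => ψ (l.filter (· ∈ F)) := by
    rw [popExp_eq_sum]
    exact Finset.sum_nonneg fun l _ => mul_nonneg ENNReal.toReal_nonneg (hψ _)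
  have hexp : popExp D (fun l => ψ (l.filter (· ∈ F)) * (1 + ∑ k ∈ Finset.range n,
        ∑ x ∈ f^[k + 1] F \ f^[k] F, if favorite l (f^[k + 1] F) = some x then 1 else 0)) =
      popExp D (fun l => ψ (l.filter (· ∈ F))) * (1 + ∑ k ∈ Finset.range n,
        ∑ x ∈ f^[k + 1] F \ f^[k] F, D x / ∑ b ∈ f^[k + 1] F, (D b : ℝ)) := by
    simp only [mul_add, mul_one, Finset.mul_sum]
    rw [popExp_add, popExp_sum]
    congr 1
    refine Finset.sum_congr rfl fun k _ => ?_
    rw [popExp_sum]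
    refine Finset.sum_congr rfl fun x hx => ?_
    rw [Finset.mem_sdiff] at hx
    rw [popExp_filter_mul_favorite (hsub' (k + 1)) hx.1 (fun h => hx.2 (hsub' k h)), mul_comm]
  rw [hexp]
  refine mul_le_mul_of_nonneg_left (add_le_add_right ?_ 1) hpr
  rw [show Real.log (∑ x ∈ F, (D x : ℝ)) = Real.log (∑ x ∈ f^[0] F, (D x : ℝ)) from rfl,
    ← Finset.sum_range_sub fun k => Real.log (∑ x ∈ f^[k] F, (D x : ℝ))]
  refine Finset.sum_le_sum fun k _ => ?_
  have h1 : ∑ x ∈ f^[k + 1] F \ f^[k] F, (D x : ℝ) =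
      ∑ x ∈ f^[k + 1] F, (D x : ℝ) - ∑ x ∈ f^[k] F, (D x : ℝ) := by
    rw [eq_sub_iff_add_eq, Finset.sum_sdiff (hsub k)]
  rw [← Finset.sum_div, h1, sub_div, div_self (hpos (k + 1)).ne']
  have h2 := Real.log_le_sub_one_of_pos (div_pos (hpos k) (hpos (k + 1)))
  rw [Real.log_div (hpos k).ne' (hpos (k + 1)).ne'] at h2
  linarith

/-- The entropy bound replaces the deterministic ratio of `D(B)` to `D(F)` by the popularities of
the two random favourites, which can later be regrouped over matchings. -/
theorem popExp_indicator_mul_gain {F B : Finset α} (hFB : F ⊆ B) (hB : B ⊆ acceptable D)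
    (hF0 : F.Nonempty) {K : ℝ} (hK : ((B \ F).card : ℝ) + 1 ≤ K)
    {ψ : List α → ℝ} (hψ : ∀ l, 0 ≤ ψ l) :
    popExp D (fun l => ψ (l.filter (· ∈ F))) *
        (1 + (Real.log (∑ x ∈ B, (D x : ℝ)) - Real.log (∑ x ∈ F, (D x : ℝ)))) ≤
      popExp D (fun l => ψ (l.filter (· ∈ F)) *
        (1 + Real.log K + (logPop D (favorite l B) - logPop D (favorite l F)))) := by
  have hD : ∀ x ∈ B, 0 < (D x : ℝ) := fun x hx => NNReal.coe_pos.2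
    (pos_iff_ne_zero.2 (mem_acceptable.1 (hB hx)))
  have hpos : 0 < ∑ x ∈ F, (D x : ℝ) := Finset.sum_pos (fun x hx => hD x (hFB hx)) hF0
  have hpr : 0 ≤ popExp D fun l => ψ (l.filter (· ∈ F)) := by
    rw [popExp_eq_sum]
    exact Finset.sum_nonneg fun l _ => mul_nonneg ENNReal.toReal_nonneg (hψ _)
  set c := Real.log (∑ x ∈ F, (D x : ℝ)) with hc
  have hent := log_sub_log_le (B \ F) (fun x => (D x : ℝ))
    (fun x hx => hD x (Finset.mem_sdiff.1 hx).1) hpos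
    (b := ∑ x ∈ B, (D x : ℝ)) (by rw [add_comm, Finset.sum_sdiff hFB]) hK
  calc _ ≤ popExp D (fun l => ψ (l.filter (· ∈ F))) * (1 + Real.log K +
        ∑ x ∈ B \ F, (D x : ℝ) / (∑ x ∈ B, (D x : ℝ)) * (Real.log (D x) - c)) :=
        mul_le_mul_of_nonneg_left (by linarith) hpr
    _ = popExp D (fun l => ψ (l.filter (· ∈ F)) * (1 + Real.log K + ∑ x ∈ B \ F,
          (if favorite l B = some x then 1 else 0) * (Real.log (D x) - c))) := by
        simp only [mul_add _ (1 + Real.log K), Finset.mul_sum, ← mul_assoc]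
        rw [popExp_add, popExp_mul_const, popExp_sum]
        congr 1
        refine Finset.sum_congr rfl fun x hx => ?_
        rw [Finset.mem_sdiff] at hx
        rw [popExp_mul_const, popExp_filter_mul_favorite hFB hx.1 hx.2]
        ring
    _ ≤ _ := by
        refine popExp_mono fun l hl => mul_le_mul_of_nonneg_left
          (add_le_add_right ?_ (1 + Real.log K)) (hψ _)
        obtain ⟨z, hz⟩ := hF0
        obtain ⟨y, hy⟩ := exists_favorite hz ((hl z).2 (hB (hFB hz)))
        obtain ⟨x, hx⟩ := exists_favorite (hFB hz) ((hl z).2 (hB (hFB hz)))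
        have hy' := mem_of_favorite hy
        have hx' := mem_of_favorite hx
        simp only [hx, hy, logPop, Option.elim_some, Option.some.injEq, ite_mul, one_mul, zero_mul,
          Finset.sum_ite_eq, Finset.mem_sdiff]
        -- If the favourite in `B` lies in `F`, the two favourites coincide and the difference
        -- vanishes. Otherwise `D(F)` is at least the popularity of the favourite `y` in `F`.
        by_cases hxF : x ∈ F
        · have := favorite_of_subset hFB hx hxF
          rw [hy, Option.some.injEq] at this
          simp [hxF, this]
        · rw [if_pos ⟨hx'.1, hxF⟩, sub_le_sub_iff_left]
          exact Real.log_le_log (hD y (hFB hy'.1))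
            (Finset.single_le_sum (f := fun x => (D x : ℝ)) (fun x _ => (D x).2) hy'.1)

/-- The expected number of partners, compared to the best and the worst one. -/
theorem popExp_card_le (hf : Monotone f) (hacc : ∀ S, f S ⊆ acceptable D) {K : ℝ}
    (hK : ∀ S, (f S).Nonempty → ((leastClosed f \ f S).card : ℝ) + 1 ≤ K)
    (H : List α → Finset α)
    (hH : ∀ l, (∀ a, a ∈ l ↔ a ∈ acceptable D) → ∀ h ∈ H l, h ∈ leastClosed f ∧
      ∀ S, h ∉ S → ∀ x ∈ f S, l.idxOf h ≤ l.idxOf x) :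
    popExp D (fun l => ((H l).card : ℝ)) ≤ popExp D (fun l =>
      if leastClosed f = ∅ then 0 else 1 + Real.log K +
        (logPop D (favorite l (leastClosed f)) - logPop D (favorite l (finalProposers f l)))) := by
  by_cases hB : leastClosed f = ∅
  · simp only [hB, if_true]
    refine popExp_mono fun l hl => ?_
    have : H l = ∅ := Finset.eq_empty_of_forall_notMem fun h hh => by
      simpa [hB] using (hH l hl h hh).1
    simp [this]
  simp only [hB, if_false]
  -- Split according to the final set, with an indicator that reads only the order of that set.
  have hdec : ∀ φ : List α → ℝ, popExp D φ =
      ∑ F, popExp D fun l => (if finalProposers f (l.filter (· ∈ F)) = F then 1 else 0) * φ l := by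
    intro φ
    rw [← popExp_sum]
    congr 1
    funext l
    simp [finalProposers_eq_iff hf]
  rw [hdec fun l => ((H l).card : ℝ), hdec]
  refine Finset.sum_le_sum fun F _ => ?_
  -- A list realising `F` supplies its structural properties; sets that never occur contribute zero.
  by_cases hFl : ∃ l, finalProposers f l = F
  swap
  · push Not at hFl
    refine popExp_mono fun l _ => ?_
    simp [hFl]
  obtain ⟨l₀, hl₀⟩ := hFl
  have hFB : F ⊆ leastClosed f := hl₀ ▸ finalProposers_subset_leastClosed hf
  have hFF : F ⊆ f F := hl₀ ▸ finalProposers_subset hf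
  have hBacc : leastClosed f ⊆ acceptable D := by rw [← leastClosed_eq hf]; exact hacc _
  have hF0 : F.Nonempty := by
    rw [Finset.nonempty_iff_ne_empty, ← hl₀, Ne, finalProposers_eq_empty_iff hf]
    exact hB
  have hKF : ((leastClosed f \ F).card : ℝ) + 1 ≤ K := by
    rw [← hl₀] at hF0 ⊢
    exact hK _ hF0
  obtain ⟨n, hn⟩ := exists_iterate_eq_leastClosed hf hFF hFB
  have hψ : ∀ l, (0 : ℝ) ≤ if finalProposers f l = F then 1 else 0 := fun l => by
    split_ifs <;> norm_num
  refine le_trans (popExp_mono fun l hl => ?_) ((popExp_indicator_mul_records hf hacc hFF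
    (hFB.trans hBacc) hF0 n hψ).trans ((hn ▸ popExp_indicator_mul_gain hFB hBacc hF0 hKF hψ).trans
    (popExp_mono fun l hl => ?_)))
  · refine if h : finalProposers f (l.filter (· ∈ F)) = F then ?_ else by simp [h]
    rw [if_pos h, one_mul, one_mul]
    rw [finalProposers_eq_iff hf] at h
    have hsubl : ∀ k ≤ n, ∀ x ∈ f^[k] F, x ∈ l := fun k _ x hx =>
      (hl x).2 (hBacc (iterate_subset_leastClosed hf hFB k hx))
    have := card_le_of_favorite_iterate hf hFF hF0 (n := n) hsubl (H := H l) fun h' hh' => by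
      obtain ⟨h1, h2⟩ := hH l hl h' hh'
      have := exists_favorite_iterate (n := n) ((hl h').2 (hBacc h1)) h2
      rw [h, hn] at this
      exact this h1
    exact_mod_cast this
  · refine if h : finalProposers f (l.filter (· ∈ F)) = F then ?_ else by simp [h]
    rw [(finalProposers_eq_iff hf F).1 h, hn]

end Records

/-! ### Stable matchings for preference lists -/

section Lists

variable {X Y : Type*} [DecidableEq X] [DecidableEq Y]

/-- Mutual acceptability. -/
def Mutual (P : X → List Y) (Q : Y → List X) (x : X) (y : Y) : Prop := y ∈ P x ∧ x ∈ Q y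

/-- The rank in a preference list. -/
def rank (P : X → List Y) (x : X) (y : Y) : ℕ := (P x).idxOf y

variable {P : X → List Y} {Q : Y → List X}

omit [DecidableEq X] in
theorem strictRank_left : StrictRank (Mutual P Q) (rank P) :=
  fun _ _ _ h _ heq => (List.idxOf_inj h.1).1 heq

omit [DecidableEq Y] in
theorem strictRank_right : StrictRank (fun y x => Mutual P Q x y) (rank Q) :=
  fun _ _ _ h _ heq => (List.idxOf_inj h.2).1 heq

omit [DecidableEq X] in
theorem not_prefers_none_iff {l : List Y} {o : Option Y} :
    ¬ Prefers l none o ↔ ∀ y, o = some y → y ∈ l := by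
  cases o with
  | none => simp [Prefers]
  | some y =>
    by_cases hy : y ∈ l
    · simp [Prefers, position, hy, (List.idxOf_lt_length_of_mem hy).le]
    · simp [Prefers, position, hy]

omit [DecidableEq X] in
theorem not_prefers_some_iff {l : List Y} {o : Option Y} {y : Y} (hy : y ∈ l) :
    ¬ Prefers l (some y) o ↔ ∃ y' ∈ l, o = some y' ∧ l.idxOf y' ≤ l.idxOf y := by
  have h := List.idxOf_lt_length_of_mem hy
  cases o with
  | none => simp [Prefers, position, hy, h]
  | some z =>
    by_cases hz : z ∈ l
    · simp [Prefers, position, hy, hz]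
    · simp only [Prefers, position, hy, hz, if_true, if_false, Option.some.injEq]
      constructor
      · intro h'; omega
      · rintro ⟨y', hy', rfl, _⟩
        exact absurd hy' hz

omit [DecidableEq X] in
theorem not_prefers_of_notMem {l : List Y} {o : Option Y} {y : Y} (hy : y ∉ l) :
    ¬ Prefers l (some y) o := by
  cases o with
  | none => simp [Prefers, position, hy]
  | some z =>
    by_cases hz : z ∈ l
    · have := List.idxOf_lt_length_of_mem hz
      simp [Prefers, position, hy, hz]
      omega
    · simp [Prefers, position, hy, hz]

/-- Pairs that are not mutually acceptable never block, so only the relation `Mutual` and the ranks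
matter. -/
theorem isStable_iff {μ : X ≃. Y} :
    IsStable P Q μ ↔ StableRel (Mutual P Q) (rank P) (rank Q) fun x y => μ x = some y := by
  have hsymm : ∀ x y, μ x = some y ↔ μ.symm y = some x := fun x y => (PEquiv.eq_some_iff μ).symm
  simp only [IsStable, not_prefers_none_iff]
  constructor
  · rintro ⟨h1, h2, h3⟩
    refine ⟨fun h => ⟨h2 _ _ h, h3 _ _ ((hsymm _ _).1 h)⟩, fun h h' => ?_, fun h h' => ?_,
      fun {x y} hA => ?_⟩
    · rw [h] at h'
      exact Option.some_injective _ h'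
    · rw [hsymm] at h h'
      rw [h] at h'
      exact Option.some_injective _ h'
    · rcases not_and_or.1 (h1 x y) with h | h
      · right
        obtain ⟨x', _, h4, h5⟩ := (not_prefers_some_iff hA.2).1 h
        exact ⟨x', (hsymm _ _).2 h4, h5⟩
      · left
        obtain ⟨y', _, h4, h5⟩ := (not_prefers_some_iff hA.1).1 h
        exact ⟨y', h4, h5⟩
  · intro h
    refine ⟨fun x y => ?_, fun x y hxy => (h.acc hxy).1,
      fun y x hxy => (h.acc ((hsymm _ _).2 hxy)).2⟩
    rw [not_and_or]
    by_cases hA : Mutual P Q x y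
    · rcases h.not_blocking hA with ⟨y', h1, h2⟩ | ⟨x', h1, h2⟩
      · exact .inr ((not_prefers_some_iff hA.1).2 ⟨y', (h.acc h1).1, h1, h2⟩)
      · exact .inl ((not_prefers_some_iff hA.2).2
          ⟨x', (h.acc h1).2, (hsymm _ _).1 h1, h2⟩)
    · rcases not_and_or.1 hA with hA | hA
      · exact .inr (not_prefers_of_notMem hA)
      · exact .inl (not_prefers_of_notMem hA)

theorem IsStable.symm {μ : X ≃. Y} (h : IsStable P Q μ) : IsStable Q P μ.symm :=
  ⟨fun y x h' => h.1 x y h'.symm, h.2.2, h.2.1⟩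

omit [DecidableEq X] [DecidableEq Y] in
theorem exists_pequiv {E : X → Y → Prop} (hl : ∀ {x y y'}, E x y → E x y' → y = y')
    (hr : ∀ {x x' y}, E x y → E x' y → x = x') : ∃ μ : X ≃. Y, ∀ x y, μ x = some y ↔ E x y := by
  classical
  have h1 : ∀ x y, (if h : ∃ y, E x y then some h.choose else none) = some y ↔ E x y := by
    intro x y
    by_cases h : ∃ y, E x y
    · rw [dif_pos h, Option.some.injEq]
      exact ⟨fun h' => h' ▸ h.choose_spec, fun h' => hl h.choose_spec h'⟩
    · rw [dif_neg h]
      simp only [reduceCtorEq, false_iff]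
      exact fun h' => h ⟨y, h'⟩
  have h2 : ∀ y x, (if h : ∃ x, E x y then some h.choose else none) = some x ↔ E x y := by
    intro y x
    by_cases h : ∃ x, E x y
    · rw [dif_pos h, Option.some.injEq]
      exact ⟨fun h' => h' ▸ h.choose_spec, fun h' => hr h.choose_spec h'⟩
    · rw [dif_neg h]
      simp only [reduceCtorEq, false_iff]
      exact fun h' => h ⟨x, h'⟩
  exact ⟨⟨_, _, fun x y => (h2 y x).trans (h1 x y).symm⟩, h1⟩

theorem StableRel.exists_isStable {E : X → Y → Prop}
    (h : StableRel (Mutual P Q) (rank P) (rank Q) E) :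
    ∃ μ : X ≃. Y, IsStable P Q μ ∧ ∀ x y, μ x = some y ↔ E x y := by
  obtain ⟨μ, hμ⟩ := exists_pequiv (E := E) h.left h.right
  refine ⟨μ, isStable_iff.2 ?_, hμ⟩
  simpa only [hμ] using h

theorem exists_isStable_optimal (P : X → List Y) (Q : Y → List X) :
    ∃ μ : X ≃. Y, IsStable P Q μ ∧ ∀ μ' : X ≃. Y, IsStable P Q μ' → ∀ x y, μ' x = some y →
      ∃ y', μ x = some y' ∧ (P x).idxOf y' ≤ (P x).idxOf y := by
  obtain ⟨E, hE, hopt⟩ := exists_optimal (A := Mutual P Q) (p := rank P) (q := rank Q)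
    strictRank_left strictRank_right
  obtain ⟨μ, hμ, h⟩ := hE.exists_isStable
  refine ⟨μ, hμ, fun μ' hμ' x y hxy => ?_⟩
  obtain ⟨y', h1, h2⟩ := hopt _ (isStable_iff.1 hμ') hxy
  exact ⟨y', (h _ _).2 h1, h2⟩

/-- The stable matching that gives to all `x : X` their best stable partner. -/
noncomputable def optimal (P : X → List Y) (Q : Y → List X) : X ≃. Y :=
  (exists_isStable_optimal P Q).choose

theorem isStable_optimal (P : X → List Y) (Q : Y → List X) : IsStable P Q (optimal P Q) :=
  (exists_isStable_optimal P Q).choose_spec.1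

theorem exists_optimal_le {μ : X ≃. Y} (h : IsStable P Q μ) {x : X} {y : Y} (hxy : μ x = some y) :
    ∃ y', optimal P Q x = some y' ∧ (P x).idxOf y' ≤ (P x).idxOf y :=
  (exists_isStable_optimal P Q).choose_spec.2 μ h x y hxy

/-- A person matched in some stable matching is matched to the worst stable partner in the matching
that is optimal for the other side. -/
theorem exists_optimal_symm_ge [Finite X] {μ : X ≃. Y} (h : IsStable P Q μ) {x : X} {y : Y}
    (hxy : μ x = some y) :
    ∃ x', optimal P Q x' = some y ∧ (Q y).idxOf x ≤ (Q y).idxOf x' := by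
  have hμ := isStable_iff.1 h
  -- The optimal matching improves on `μ` for all matched proposers, so it also matches every
  -- receiver that `μ` matches.
  have hopt := isStable_iff.1 (isStable_optimal P Q)
  obtain ⟨x', hx'⟩ := hμ.exists_of_improving strictRank_left
    (C := fun x y => optimal P Q x = some y) hopt.acc hopt.right
    (fun hxy => exists_optimal_le h hxy) hxy
  refine ⟨x', hx', ?_⟩
  rcases hμ.not_blocking (hopt.acc hx') with ⟨y', h1, h2⟩ | ⟨x'', h1, h2⟩
  · obtain ⟨y'', h3, h4⟩ := exists_optimal_le h h1
    rw [hx', Option.some.injEq] at h3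
    subst h3
    obtain rfl := strictRank_left (hopt.acc hx') (hμ.acc h1) (le_antisymm h4 h2)
    rw [hμ.right hxy h1]
  · rw [hμ.right hxy h1]
    exact h2

/-- The stable partners of `y`. -/
noncomputable def partners [Fintype X] (P : X → List Y) (Q : Y → List X) (y : Y) : Finset X :=
  open Classical in {x | ∃ μ : X ≃. Y, IsStable P Q μ ∧ μ x = some y}

theorem mem_partners [Fintype X] {x : X} {y : Y} :
    x ∈ partners P Q y ↔ ∃ μ : X ≃. Y, IsStable P Q μ ∧ μ x = some y := by
  simp [partners]

/-- A bound for the number of stable partners of `y`, correct in expectation. -/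
noncomputable def gain (D : X → ℝ≥0) (K : ℝ) (P : X → List Y) (Q : Y → List X) (y : Y) : ℝ :=
  if (optimal P Q).symm y = none then 0
  else 1 + Real.log K + (logPop D (optimal Q P y) - logPop D ((optimal P Q).symm y))

variable [Fintype X] {y₀ : Y}

/-- If `f S` is the set of proposers when `y₀` rejects `S`, then the favourite in the least closed
set is the best stable partner of `y₀`, and the favourite of the final proposers is the worst
one. -/
theorem favorite_eq_optimal {f : Finset X → Finset X}
    (hf : proposers (Mutual P Q) (rank P) (rank Q) y₀ = f) :
    favorite (Q y₀) (leastClosed f) = optimal Q P y₀ ∧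
      favorite (Q y₀) (finalProposers f (Q y₀)) = (optimal P Q).symm y₀ := by
  have hmono : Monotone f := hf ▸ proposers_mono
  have hmem : ∀ S, ∀ x ∈ f S, x ∈ Q y₀ := fun S x hx => by
    rw [← hf] at hx
    exact (acc_of_mem_proposers hx).2
  have hB : ∀ {μ : X ≃. Y} {x : X}, IsStable P Q μ → μ x = some y₀ → x ∈ leastClosed f :=
    fun hμ hx => (isStable_iff.1 hμ).mem_of_proposers_subset strictRank_left strictRank_right hx
      (hf ▸ (leastClosed_eq hmono).subset)
  have hBmem : ∀ x ∈ leastClosed f, x ∈ Q y₀ := by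
    rw [← leastClosed_eq hmono]
    exact hmem _
  have hlt : ∀ {F : Finset X} {b x : X}, favorite (Q y₀) F = some b → x ∈ F → x ≠ b →
      rank Q y₀ b < rank Q y₀ x := fun hb hx hxb =>
    lt_of_le_of_ne (idxOf_favorite_le hb hx) fun h =>
      hxb ((List.idxOf_inj (mem_of_favorite hb).2).1 h).symm
  rcases Finset.eq_empty_or_nonempty (leastClosed f) with hemp | ⟨z, hz⟩
  · have h1 : ∀ F : Finset X, F = ∅ → favorite (Q y₀) F = none := by
      rintro _ rfl
      simp [favorite]
    rw [h1 _ hemp, h1 _ ((finalProposers_eq_empty_iff hmono).2 hemp)]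
    constructor
    · symm
      rw [Option.eq_none_iff_forall_ne_some]
      intro x hx
      have := hB (isStable_optimal Q P).symm ((PEquiv.eq_some_iff _).2 hx)
      simp [hemp] at this
    · symm
      rw [Option.eq_none_iff_forall_ne_some]
      intro x hx
      have := hB (isStable_optimal P Q) ((PEquiv.eq_some_iff _).1 hx)
      simp [hemp] at this
  constructor
  · obtain ⟨b, hb⟩ := exists_favorite hz (hBmem z hz)
    have hbB := (mem_of_favorite hb).1
    -- Let `y₀` reject everyone except `b`. If `b` never proposed, this `S` would be closed under
    -- `f` and would contain `leastClosed f`, hence `b`.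
    set S := leastClosed fun S => (f S).erase b with hS
    have hS1 : (f S).erase b = S := leastClosed_eq (f := fun S => (f S).erase b)
      fun S T h => Finset.erase_subset_erase _ (hmono h)
    have hbS : b ∉ S := by
      rw [← hS1]
      simp
    have hSB : S ⊆ leastClosed f := leastClosed_subset (by
      rw [leastClosed_eq hmono]
      exact Finset.erase_subset _ _)
    have hbf : b ∈ f S := by
      by_contra h
      rw [Finset.erase_eq_of_notMem h] at hS1
      exact hbS (leastClosed_subset hS1.subset hbB)
    obtain ⟨E, hE, hEb⟩ := exists_stable_of_proposers (S := S) (h := b)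
      (strictRank_left (P := P) (Q := Q)) strictRank_right
      (by rw [hf]; exact hbf) hbS
      (fun x hx => hlt hb (hSB hx) fun h => hbS (h ▸ hx))
      (fun x hx hxb => by rw [hf] at hx; rw [← hS1]; exact Finset.mem_erase.2 ⟨hxb, hx⟩)
    obtain ⟨μ, hμ, hμE⟩ := hE.exists_isStable
    obtain ⟨b', hb', hle⟩ := exists_optimal_le hμ.symm
      ((PEquiv.eq_some_iff μ).2 ((hμE b y₀).2 hEb))
    have hb'B := hB (isStable_optimal Q P).symm ((PEquiv.eq_some_iff _).2 hb')
    rw [hb, hb', (List.idxOf_inj (mem_of_favorite hb).2).1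
      (le_antisymm (idxOf_favorite_le hb hb'B) hle)]
  · obtain ⟨z, hz⟩ : (finalProposers f (Q y₀)).Nonempty := by
      rw [Finset.nonempty_iff_ne_empty, Ne, finalProposers_eq_empty_iff hmono]
      exact Finset.ne_empty_of_mem hz
    obtain ⟨w, hw⟩ := exists_favorite hz (hmem _ z hz)
    have hrej := rejected_finalProposers (l := Q y₀) hmono
    have hwS : w ∉ finalRejected f (Q y₀) := by
      rw [← hrej, rejected, Finset.mem_filter]
      exact fun h => h.2 hw
    obtain ⟨E, hE, hEw⟩ := exists_stable_of_proposers (S := finalRejected f (Q y₀)) (h := w)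
      (strictRank_left (P := P) (Q := Q)) strictRank_right
      (by rw [hf]; exact (mem_of_favorite hw).1) hwS
      (fun x hx => hlt hw (finalRejected_subset_finalProposers hmono hx) fun h => hwS (h ▸ hx))
      (fun x hx hxw => by
        rw [hf] at hx
        rw [← hrej, rejected, Finset.mem_filter, hw]
        exact ⟨hx, fun h => hxw (Option.some_injective _ h).symm⟩)
    obtain ⟨μ, hμ, hμE⟩ := hE.exists_isStable
    obtain ⟨w', hw', hle⟩ := exists_optimal_symm_ge hμ ((hμE w y₀).2 hEw)
    have hsub := finalProposers_subset (l := Q y₀) hmono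
    obtain ⟨n, hn⟩ := exists_iterate_eq_leastClosed hmono hsub
      (finalProposers_subset_leastClosed hmono)
    have hw'B := hB (isStable_optimal P Q) hw'
    -- The worst stable partner `w'` is the favourite in a set containing `w`, so he ranks at least
    -- as high as `w`. As `w` is a stable partner too, they agree.
    obtain ⟨k, _, hk⟩ := exists_favorite_iterate (f := f) (n := n) (hBmem _ hw'B)
      (fun S hS x hx => (isStable_iff.1 (isStable_optimal P Q)).le_of_mem_proposers
        strictRank_left hw' hS (hf ▸ hx)) (hn ▸ hw'B)
    have hwk : ∀ k, finalProposers f (Q y₀) ⊆ f^[k] (finalProposers f (Q y₀)) := by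
      intro k
      induction k with
      | zero => exact subset_rfl
      | succ k ih =>
        rw [Function.iterate_succ_apply]
        exact ih.trans (hmono.iterate k hsub)
    rw [hw, (PEquiv.eq_some_iff _).2 hw', (List.idxOf_inj (mem_of_favorite hw).2).1
      (le_antisymm hle (idxOf_favorite_le hk (hwk k (mem_of_favorite hw).1)))]

/-- The expected number of stable partners of `y₀`, when only the list of `y₀` is random. -/
theorem popExp_card_partners_le [Fintype Y] (P : X → List Y) (Q : Y → List X) (y₀ : Y) (D : X → ℝ≥0) :
    popExp D (fun l => ((partners P (Function.update Q y₀ l) y₀).card : ℝ)) ≤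
      popExp D fun l => gain D (min (acceptable D).card (Fintype.card Y) : ℕ) P
        (Function.update Q y₀ l) y₀ := by
  -- An arbitrary reference order: `f` depends on the list of `y₀` only through the set of
  -- acceptable partners.
  set Q₁ := Function.update Q y₀ (acceptable D).toList with hQ₁
  set f := proposers (Mutual P Q₁) (rank P) (rank Q₁) y₀ with hf
  have hmono : Monotone f := proposers_mono
  have hacc : ∀ S, f S ⊆ acceptable D := fun S x hx => by
    have := (acc_of_mem_proposers hx).2
    simpa [hQ₁] using this
  have hBacc : leastClosed f ⊆ acceptable D := by rw [← leastClosed_eq hmono]; exact hacc _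
  have hfl : ∀ l, (∀ a, a ∈ l ↔ a ∈ acceptable D) →
      proposers (Mutual P (Function.update Q y₀ l)) (rank P)
        (rank (Function.update Q y₀ l)) y₀ = f := by
    intro l hl
    have hM : Mutual P (Function.update Q y₀ l) = Mutual P Q₁ := by
      funext x y
      by_cases hy : y = y₀
      · subst hy
        simp [Mutual, hQ₁, hl]
      · simp [Mutual, hQ₁, hy]
    rw [hM]
    refine proposers_congr fun y hy => ?_
    funext x
    simp [rank, hQ₁, hy]
  refine (popExp_card_le hmono hacc (K := ((min (acceptable D).card (Fintype.card Y) : ℕ) : ℝ))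
    ?_ _ ?_).trans (popExp_mono fun l hl => ?_)
  · rintro S ⟨x, hx⟩
    have h1 : (leastClosed f \ f S).card < (acceptable D).card := by
      refine Finset.card_lt_card ⟨Finset.sdiff_subset.trans hBacc, fun h => ?_⟩
      exact (Finset.mem_sdiff.1 (h (hacc S hx))).2 hx
    have h2 : (leastClosed f \ f S).card < Fintype.card Y :=
      card_sdiff_proposers_lt strictRank_right fun x hx => by
        rw [← leastClosed_eq hmono] at hx
        exact acc_of_mem_proposers hx
    exact_mod_cast le_min h1 h2
  · intro l hl h hh
    obtain ⟨μ, hμ, hx⟩ := mem_partners.1 hh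
    have hμ' := isStable_iff.1 hμ
    refine ⟨hμ'.mem_of_proposers_subset strictRank_left strictRank_right hx
      (by rw [hfl l hl]; exact (leastClosed_eq hmono).subset), fun S hS x hxS => ?_⟩
    rw [← hfl l hl] at hxS
    have := hμ'.le_of_mem_proposers strictRank_left hx hS hxS
    simpa [rank] using this
  · have h := favorite_eq_optimal (hfl l hl)
    rw [Function.update_self] at h
    rw [gain, ← h.1, ← h.2]
    by_cases hB : leastClosed f = ∅
    · rw [if_pos hB, if_pos]
      rw [(finalProposers_eq_empty_iff hmono).2 hB]
      simp [favorite]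
    · rw [if_neg hB, if_neg]
      rw [← finalProposers_eq_empty_iff (l := l) hmono] at hB
      obtain ⟨z, hz⟩ := Finset.nonempty_iff_ne_empty.2 hB
      obtain ⟨w, hw⟩ := exists_favorite (l := l) hz ((hl z).2 (hacc _ hz))
      simp [hw]

end Lists

/-! ### The expectation over all preference lists -/

section Profile

/-- The law is carried by a finite set, so the integral is a finite sum for every `f`, with no
measurability or integrability condition. -/
theorem integral_eq_sum_of_measure_finset {Ω : Type*} [MeasurableSpace Ω]
    [MeasurableSingletonClass Ω] (μ : MeasureTheory.Measure Ω)
    [MeasureTheory.IsProbabilityMeasure μ] (T : Finset Ω) (hT : μ T = 1) (f : Ω → ℝ) :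
    ∫ x, f x ∂μ = ∑ x ∈ T, μ.real {x} * f x := by
  have h0 : μ (T : Set Ω)ᶜ = 0 := (MeasureTheory.prob_compl_eq_zero_iff T.measurableSet).2 hT
  have hr : μ.restrict (T : Set Ω) = μ :=
    MeasureTheory.Measure.restrict_eq_self_of_ae_mem (MeasureTheory.mem_ae_iff.2 h0)
  conv_lhs => rw [← hr]
  rw [MeasureTheory.setIntegral_finset _ MeasureTheory.IntegrableOn.finset]
  rfl

variable {α : Type*} [Fintype α]

theorem toMeasure_popularityList_listsUpTo [DecidableEq α] (D : α → ℝ≥0) :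
    (popularityList D).toMeasure (listsUpTo α (Fintype.card α) : Set (List α)) = 1 := by
  have h := popExp_one D
  rw [popExp_eq_sum] at h
  simp only [mul_one] at h
  rw [PMF.toMeasure_apply_finset, ← ENNReal.toReal_eq_one_iff, ENNReal.toReal_sum
    fun l _ => (popularityList D).apply_ne_top l]
  exact h

instance {α : Type*} : MeasurableSingletonClass (List α) := ⟨fun _ => trivial⟩

/-- The probability of the preference lists `P`. -/
noncomputable def weight {ι : Type*} [Fintype ι] (D : ι → α → ℝ≥0) (P : ι → List α) : ℝ :=
  ∏ i, (popularityList (D i) (P i)).toReal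

variable {M W : Type*} [Fintype M] [Fintype W] [DecidableEq M] [DecidableEq W]

/-- The possible families of preference lists. -/
noncomputable def families (ι α : Type*) [Fintype ι] [DecidableEq ι] [Fintype α] :
    Finset (ι → List α) :=
  Fintype.piFinset fun _ => listsUpTo α (Fintype.card α)

theorem pi_families {ι : Type*} [Fintype ι] [DecidableEq ι] [DecidableEq α] (D : ι → α → ℝ≥0) :
    (MeasureTheory.Measure.pi fun i => (popularityList (D i)).toMeasure)
      (families ι α : Set (ι → List α)) = 1 := by
  rw [families, Fintype.coe_piFinset, MeasureTheory.Measure.pi_pi]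
  exact Finset.prod_eq_one fun i _ => toMeasure_popularityList_listsUpTo (D i)

theorem integral_profileLaw (DM : M → W → ℝ≥0) (DW : W → M → ℝ≥0)
    (f : (M → List W) × (W → List M) → ℝ) :
    ∫ x, f x ∂profileLaw DM DW =
      ∑ P ∈ families M W, weight DM P * ∑ Q ∈ families W M, weight DW Q * f (P, Q) := by
  have : MeasureTheory.IsProbabilityMeasure (profileLaw DM DW) := by
    unfold profileLaw
    infer_instance
  have hone : profileLaw DM DW (families M W ×ˢ families W M : Finset _) = 1 := by
    rw [Finset.coe_product, profileLaw, MeasureTheory.Measure.prod_prod, pi_families,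
      pi_families, one_mul]
  rw [integral_eq_sum_of_measure_finset _ _ hone, Finset.sum_product]
  refine Finset.sum_congr rfl fun P _ => ?_
  rw [Finset.mul_sum]
  refine Finset.sum_congr rfl fun Q _ => ?_
  rw [← mul_assoc]
  congr 1
  rw [MeasureTheory.measureReal_def, profileLaw, ← Set.singleton_prod_singleton,
    MeasureTheory.Measure.prod_prod, MeasureTheory.Measure.pi_singleton,
    MeasureTheory.Measure.pi_singleton, ENNReal.toReal_mul, ENNReal.toReal_prod,
    ENNReal.toReal_prod, weight, weight]
  simp only [PMF.toMeasure_apply_singleton _ _ (MeasurableSet.singleton _)]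

theorem weight_nonneg {ι : Type*} [Fintype ι] (D : ι → α → ℝ≥0) (P : ι → List α) :
    0 ≤ weight D P :=
  Finset.prod_nonneg fun _ _ => ENNReal.toReal_nonneg

theorem mem_iff_of_weight_ne_zero {ι : Type*} [Fintype ι] {D : ι → α → ℝ≥0} {P : ι → List α}
    (h : weight D P ≠ 0) (i : ι) (a : α) : a ∈ P i ↔ a ∈ acceptable (D i) := by
  refine mem_iff_of_popularityList_ne_zero _ _ (fun h0 => ?_) a
  exact Finset.prod_ne_zero_iff.1 h i (Finset.mem_univ i) (by rw [h0]; rfl)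

theorem sum_weight {ι : Type*} [Fintype ι] [DecidableEq ι] [DecidableEq α] (D : ι → α → ℝ≥0) :
    ∑ P ∈ families ι α, weight D P = 1 := by
  simp only [families, weight]
  rw [Finset.sum_prod_piFinset _ fun i l => (popularityList (D i) l).toReal]
  refine Finset.prod_eq_one fun i _ => ?_
  have h := popExp_one (D i)
  rw [popExp_eq_sum] at h
  simpa using h

/-- One list may be drawn again. -/
theorem sum_weight_mul_eq {ι : Type*} [Fintype ι] [DecidableEq ι] [DecidableEq α]
    (D : ι → α → ℝ≥0) (i : ι) (g : (ι → List α) → ℝ) :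
    ∑ P ∈ families ι α, weight D P * g P =
      ∑ P ∈ families ι α, weight D P * popExp (D i) fun l => g (Function.update P i l) := by
  have h1 := popExp_one (D i)
  simp only [popExp_eq_sum, mul_one] at h1 ⊢
  have hmem : ∀ P : ι → List α, P ∈ families ι α ↔
      ∀ j, P j ∈ listsUpTo α (Fintype.card α) := fun P => by simp [families]
  have hw : ∀ (P : ι → List α) (l : List α),
      weight D (Function.update P i l) * (popularityList (D i) (P i)).toReal =
        weight D P * (popularityList (D i) l).toReal := by
    intro P l
    rw [weight, weight, ← Finset.mul_prod_erase _ _ (Finset.mem_univ i),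
      ← Finset.mul_prod_erase _ (fun j => (popularityList (D j) (P j)).toReal)
        (Finset.mem_univ i), Function.update_self, Finset.prod_congr rfl fun j hj => by
        rw [Function.update_of_ne (Finset.ne_of_mem_erase hj)]]
    ring
  calc _ = ∑ P ∈ families ι α, ∑ l ∈ listsUpTo α (Fintype.card α),
        weight D P * (popularityList (D i) l).toReal * g P := by
        refine Finset.sum_congr rfl fun P _ => ?_
        rw [← Finset.sum_mul, ← Finset.mul_sum, h1, mul_one]
    _ = ∑ P ∈ families ι α, ∑ l ∈ listsUpTo α (Fintype.card α),
        weight D P * (popularityList (D i) l).toReal * g (Function.update P i l) := by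
        rw [← Finset.sum_product', ← Finset.sum_product']
        -- Exchanging the old list of `i` with the fresh one is an involution that preserves the
        -- joint weight.
        refine Finset.sum_nbij' (fun x => (Function.update x.1 i x.2, x.1 i))
          (fun x => (Function.update x.1 i x.2, x.1 i)) ?_ ?_ ?_ ?_ ?_
        · rintro ⟨P, l⟩ hx
          simp only [Finset.mem_product, hmem] at hx ⊢
          refine ⟨fun j => ?_, hx.1 i⟩
          by_cases hj : j = i
          · subst hj; simpa using hx.2
          · simpa [hj] using hx.1 j
        · rintro ⟨P, l⟩ hx
          simp only [Finset.mem_product, hmem] at hx ⊢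
          refine ⟨fun j => ?_, hx.1 i⟩
          by_cases hj : j = i
          · subst hj; simpa using hx.2
          · simpa [hj] using hx.1 j
        · rintro ⟨P, l⟩ _
          simp
        · rintro ⟨P, l⟩ _
          simp
        · rintro ⟨P, l⟩ _
          simp [hw]
    _ = _ := by
        refine Finset.sum_congr rfl fun P _ => ?_
        rw [Finset.mul_sum]
        exact Finset.sum_congr rfl fun l _ => by ring

/-- The expected number of stable partners, summed over one side. -/
theorem sum_weight_partners_le (DM : M → W → ℝ≥0) (DW : W → M → ℝ≥0) :
    ∑ P ∈ families M W, weight DM P * ∑ Q ∈ families W M, weight DW Q *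
        ∑ w, ((partners P Q w).card : ℝ) ≤
      ∑ P ∈ families M W, weight DM P * ∑ Q ∈ families W M, weight DW Q *
        ∑ w, gain (DW w) (min (acceptable (DW w)).card (Fintype.card W) : ℕ) P Q w := by
  refine Finset.sum_le_sum fun P _ => mul_le_mul_of_nonneg_left ?_ (weight_nonneg _ _)
  simp only [Finset.mul_sum]
  rw [Finset.sum_comm, Finset.sum_comm (s := families W M)]
  refine Finset.sum_le_sum fun w _ => ?_
  -- Redraw the list of `w` alone, so that the bound for one random list applies with the others
  -- fixed.
  rw [sum_weight_mul_eq DW w, sum_weight_mul_eq DW w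
    fun Q => gain (DW w) (min (acceptable (DW w)).card (Fintype.card W) : ℕ) P Q w]
  exact Finset.sum_le_sum fun Q _ => mul_le_mul_of_nonneg_left
    (popExp_card_partners_le P Q w (DW w)) (weight_nonneg _ _)

end Profile

/-! ### Sums over the pairs of a matching -/

section Sums

variable {X Y : Type*} [Fintype X] [Fintype Y] [DecidableEq X] [DecidableEq Y]

omit [DecidableEq Y] in
theorem sum_matched_le (μ : X ≃. Y) {c : ℝ} (hc : 0 ≤ c) :
    ∑ y, (if μ.symm y = none then 0 else c) ≤ (min (Fintype.card X) (Fintype.card Y) : ℕ) * c := by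
  rw [Finset.sum_ite, Finset.sum_const_zero, zero_add, Finset.sum_const, nsmul_eq_mul]
  refine mul_le_mul_of_nonneg_right (Nat.cast_le.2 (le_min ?_ (Finset.card_le_univ _))) hc
  rw [← Finset.card_univ, ← Finset.card_image_of_injective _ (Option.some_injective X)]
  refine Finset.card_le_card_of_injOn μ.symm ?_ ?_
  · intro y hy
    simp only [Finset.coe_filter, Finset.mem_univ, true_and, Set.mem_ofPred_eq] at hy
    obtain ⟨x, hx⟩ := Option.ne_none_iff_exists'.1 hy
    simp [hx]
  · intro y hy y' _ h
    simp only [Finset.coe_filter, Finset.mem_univ, true_and, Set.mem_ofPred_eq] at hy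
    obtain ⟨x, hx⟩ := Option.ne_none_iff_exists'.1 hy
    exact μ.symm.inj hx (h ▸ hx)

theorem sum_elim_symm (μ : X ≃. Y) (g : Y → X → ℝ) :
    ∑ y, (μ.symm y).elim 0 (g y) = ∑ x, (μ x).elim 0 fun y => g y x := by
  have h1 : ∀ y, (μ.symm y).elim 0 (g y) = ∑ x, if μ x = some y then g y x else 0 := by
    intro y
    simp only [← PEquiv.eq_some_iff μ]
    rcases μ.symm y with _ | x <;> simp
  have h2 : ∀ x, (μ x).elim 0 (fun y => g y x) = ∑ y, if μ x = some y then g y x else 0 := by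
    intro x
    rcases μ x with _ | y <;> simp
  simp only [h1, h2]
  exact Finset.sum_comm

/-- Both sums run over the same matched pairs; each pair contributes the logarithm of a ratio that
is at most `r`. -/
theorem sum_logPop_sub_le (μ : X ≃. Y) (DX : X → Y → ℝ≥0) (DY : Y → X → ℝ≥0) {r : ℝ} (hr : 1 ≤ r)
    (h : ∀ x y, μ x = some y → DX x y ≠ 0 ∧ DY y x ≠ 0 ∧ (DX x y : ℝ) ≤ r * DY y x) :
    ∑ x, logPop (DX x) (μ x) - ∑ y, logPop (DY y) (μ.symm y) ≤
      (min (Fintype.card X) (Fintype.card Y) : ℕ) * Real.log r := by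
  simp only [logPop]
  rw [sum_elim_symm μ fun y x => Real.log (DY y x), ← Finset.sum_sub_distrib]
  have := sum_matched_le μ.symm (Real.log_nonneg hr)
  rw [PEquiv.symm_symm, min_comm] at this
  refine le_trans (Finset.sum_le_sum fun x _ => ?_) this
  rcases hx : μ x with _ | y
  · simp
  · obtain ⟨h1, h2, h3⟩ := h x y hx
    have h1' : 0 < (DX x y : ℝ) := NNReal.coe_pos.2 (pos_iff_ne_zero.2 h1)
    have h2' : 0 < (DY y x : ℝ) := NNReal.coe_pos.2 (pos_iff_ne_zero.2 h2)
    have := Real.log_le_log h1' h3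
    rw [Real.log_mul (by positivity) h2'.ne'] at this
    simp
    linarith

theorem sum_gain_eq (P : X → List Y) (Q : Y → List X) (DY : Y → X → ℝ≥0) (K : Y → ℝ) :
    ∑ y, gain (DY y) (K y) P Q y =
      ∑ y, (if (optimal P Q).symm y = none then 0 else 1 + Real.log (K y)) +
        (∑ y, logPop (DY y) (optimal Q P y) - ∑ y, logPop (DY y) ((optimal P Q).symm y)) := by
  rw [← Finset.sum_sub_distrib, ← Finset.sum_add_distrib]
  refine Finset.sum_congr rfl fun y _ => ?_
  rw [gain]
  split_ifs with h
  -- A person single in one optimal matching is single in the other, so both logarithms are zero and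
  -- the splitting remains exact.
  · have : optimal Q P y = none := by
      rw [Option.eq_none_iff_forall_ne_some]
      intro x hx
      obtain ⟨x', hx', _⟩ := exists_optimal_symm_ge (isStable_optimal Q P).symm
        ((PEquiv.eq_some_iff _).2 hx)
      rw [(PEquiv.eq_some_iff _).2 hx'] at h
      cases h
    rw [this, h]
    simp
  · rfl

theorem mem_partners_comm {P : X → List Y} {Q : Y → List X} {x : X} {y : Y} :
    x ∈ partners P Q y ↔ y ∈ partners Q P x := by
  rw [mem_partners, mem_partners]
  constructor
  · rintro ⟨μ, hμ, h⟩
    exact ⟨μ.symm, hμ.symm, (PEquiv.eq_some_iff _).2 h⟩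
  · rintro ⟨μ, hμ, h⟩
    exact ⟨μ.symm, hμ.symm, (PEquiv.eq_some_iff _).2 h⟩

theorem ncard_stablePairs (P : X → List Y) (Q : Y → List X) :
    (stablePairs P Q).ncard = ∑ y, (partners P Q y).card ∧
      (stablePairs P Q).ncard = ∑ x, (partners Q P x).card := by
  have h : stablePairs P Q =
      ((Finset.univ.filter fun z : X × Y => z.1 ∈ partners P Q z.2 : Finset _) : Set (X × Y)) := by
    ext z
    simp [stablePairs, mem_partners]
  rw [h, Set.ncard_coe_finset, Finset.card_filter, Fintype.sum_prod_type]
  constructor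
  · rw [Finset.sum_comm]
    exact Finset.sum_congr rfl fun y _ => by simp
  · refine Finset.sum_congr rfl fun x _ => ?_
    rw [← Finset.card_filter]
    congr 1
    ext y
    rw [Finset.mem_filter_univ]
    exact mem_partners_comm

end Sums

/-! ### Combining both sides of the market -/

section Main

variable {M W : Type*} [Fintype M] [Fintype W] [DecidableEq M] [DecidableEq W]

theorem expectedStablePairs_eq (DM : M → W → ℝ≥0) (DW : W → M → ℝ≥0) :
    expectedStablePairs DM DW = ∑ P ∈ families M W, weight DM P * ∑ Q ∈ families W M,
      weight DW Q * ((stablePairs P Q).ncard : ℝ) :=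
  integral_profileLaw DM DW _

/-- A bound for the gains of all persons gives a bound for the expected number of stable pairs. -/
theorem two_mul_expectedStablePairs_le (DM : M → W → ℝ≥0) (DW : W → M → ℝ≥0) {C : ℝ}
    (hC : ∀ P Q, (∀ m w, w ∈ P m ↔ w ∈ acceptable (DM m)) →
      (∀ w m, m ∈ Q w ↔ m ∈ acceptable (DW w)) →
      ∑ w, gain (DW w) (min (acceptable (DW w)).card (Fintype.card W) : ℕ) P Q w +
        ∑ m, gain (DM m) (min (acceptable (DM m)).card (Fintype.card M) : ℕ) Q P m ≤ C) :
    2 * expectedStablePairs DM DW ≤ C := by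
  have hswap : ∀ g : (M → List W) → (W → List M) → ℝ,
      ∑ Q ∈ families W M, weight DW Q * ∑ P ∈ families M W, weight DM P * g P Q =
        ∑ P ∈ families M W, weight DM P * ∑ Q ∈ families W M, weight DW Q * g P Q := by
    intro g
    simp only [Finset.mul_sum]
    rw [Finset.sum_comm]
    exact Finset.sum_congr rfl fun _ _ => Finset.sum_congr rfl fun _ _ => by ring
  have h1 := sum_weight_partners_le DM DW
  have h2 := sum_weight_partners_le DW DM
  rw [hswap fun P Q => ∑ m, ((partners Q P m).card : ℝ), hswap fun P Q =>
    ∑ m, gain (DM m) (min (acceptable (DM m)).card (Fintype.card M) : ℕ) Q P m] at h2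
  have h3 : expectedStablePairs DM DW = ∑ P ∈ families M W, weight DM P * ∑ Q ∈ families W M,
      weight DW Q * ∑ w, ((partners P Q w).card : ℝ) := by
    rw [expectedStablePairs_eq]
    simp only [(ncard_stablePairs _ _).1, Nat.cast_sum]
  have h4 : expectedStablePairs DM DW = ∑ P ∈ families M W, weight DM P * ∑ Q ∈ families W M,
      weight DW Q * ∑ m, ((partners Q P m).card : ℝ) := by
    rw [expectedStablePairs_eq]
    simp only [(ncard_stablePairs _ _).2, Nat.cast_sum]
  have h5 : ∑ P ∈ families M W, weight DM P * ∑ Q ∈ families W M, weight DW Q *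
      (∑ w, gain (DW w) (min (acceptable (DW w)).card (Fintype.card W) : ℕ) P Q w +
        ∑ m, gain (DM m) (min (acceptable (DM m)).card (Fintype.card M) : ℕ) Q P m) ≤
      ∑ P ∈ families M W, weight DM P * ∑ Q ∈ families W M, weight DW Q * C := by
    simp only [Finset.mul_sum, ← mul_assoc]
    refine Finset.sum_le_sum fun P _ => Finset.sum_le_sum fun Q _ => ?_
    -- The hypothesis on the gains is needed only for families of positive weight, whose lists
    -- contain exactly the acceptable partners.
    by_cases hP : weight DM P = 0
    · simp [hP]
    by_cases hQ : weight DW Q = 0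
    · simp [hQ]
    exact mul_le_mul_of_nonneg_left
      (hC P Q (mem_iff_of_weight_ne_zero hP) (mem_iff_of_weight_ne_zero hQ))
      (mul_nonneg (weight_nonneg _ _) (weight_nonneg _ _))
  have h6 : ∑ P ∈ families M W, weight DM P * ∑ Q ∈ families W M, weight DW Q * C = C := by
    rw [← Finset.sum_mul, ← Finset.sum_mul, sum_weight, sum_weight, one_mul, one_mul]
  simp only [mul_add, Finset.sum_add_distrib] at h5
  linarith

variable {DM : M → W → ℝ≥0} {DW : W → M → ℝ≥0} {r : ℝ} {N : ℕ}

/-- The four sums of logarithms are paired by matching, not by side: `optimal P Q` is best for men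
and worst for women, `optimal Q P` the reverse. Each matching costs `N * log r`. -/
theorem sum_gain_add_sum_gain_le (hr : 1 ≤ r)
    (hfactor : ∀ m w, w ∈ acceptable (DM m) → m ∈ acceptable (DW w) →
      (DW w m : ℝ) ≤ r * DM m w ∧ (DM m w : ℝ) ≤ r * DW w m)
    (hN : N = min (Fintype.card M) (Fintype.card W)) {P : M → List W} {Q : W → List M}
    (hP : ∀ m w, w ∈ P m ↔ w ∈ acceptable (DM m)) (hQ : ∀ w m, m ∈ Q w ↔ m ∈ acceptable (DW w))
    (KW : W → ℝ) (KM : M → ℝ) :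
    ∑ w, gain (DW w) (KW w) P Q w + ∑ m, gain (DM m) (KM m) Q P m ≤
      ∑ w, (if (optimal P Q).symm w = none then 0 else 1 + Real.log (KW w)) +
        ∑ m, (if (optimal Q P).symm m = none then 0 else 1 + Real.log (KM m)) +
          2 * (N * Real.log r) := by
  rw [sum_gain_eq, sum_gain_eq]
  have h1 := sum_logPop_sub_le (optimal P Q) DM DW hr fun m w h => by
    obtain ⟨h1, h2⟩ := (isStable_iff.1 (isStable_optimal P Q)).acc h
    rw [hP] at h1
    rw [hQ] at h2
    exact ⟨mem_acceptable.1 h1, mem_acceptable.1 h2, (hfactor m w h1 h2).2⟩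
  have h2 := sum_logPop_sub_le (optimal Q P) DW DM hr fun w m h => by
    obtain ⟨h1, h2⟩ := (isStable_iff.1 (isStable_optimal Q P)).acc h
    rw [hQ] at h1
    rw [hP] at h2
    exact ⟨mem_acceptable.1 h1, mem_acceptable.1 h2, (hfactor m w h2 h1).1⟩
  rw [← hN] at h1
  rw [min_comm, ← hN] at h2
  linarith

theorem sum_one_add_log_le_sum {X Y : Type*} [Fintype X] [Fintype Y] [DecidableEq X]
    (μ : X ≃. Y) (hN : N = min (Fintype.card X) (Fintype.card Y)) (D : Y → X → ℝ≥0)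
    (hD : ∀ y, 1 ≤ (acceptable (D y)).card) :
    ∑ y, (if μ.symm y = none then 0
        else 1 + Real.log (min (acceptable (D y)).card (Fintype.card Y) : ℕ)) ≤
      N + ∑ y, Real.log (acceptable (D y)).card := by
  have h := sum_matched_le μ zero_le_one
  rw [← hN, mul_one] at h
  refine le_trans (Finset.sum_le_sum (g := fun y =>
    (if μ.symm y = none then 0 else 1) + Real.log (acceptable (D y)).card) fun y _ => ?_)
    (by rw [Finset.sum_add_distrib]; exact add_le_add_left h _)
  have hpos : 0 < min (acceptable (D y)).card (Fintype.card Y) :=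
    lt_min (hD y) (Fintype.card_pos_iff.2 ⟨y⟩)
  split_ifs
  · rw [zero_add]
    exact Real.log_nonneg (by exact_mod_cast hD y)
  · exact add_le_add_right (Real.log_le_log (by exact_mod_cast hpos)
      (by exact_mod_cast min_le_left _ _)) _

theorem sum_one_add_log_le_mul {X Y : Type*} [Fintype X] [Fintype Y] [DecidableEq X]
    (μ : X ≃. Y) (hN : N = min (Fintype.card X) (Fintype.card Y)) (D : Y → X → ℝ≥0)
    (hD : ∀ y, 1 ≤ (acceptable (D y)).card) :
    ∑ y, (if μ.symm y = none then 0
        else 1 + Real.log (min (acceptable (D y)).card (Fintype.card Y) : ℕ)) ≤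
      N * (1 + Real.log N) := by
  have h := sum_matched_le μ (c := 1 + Real.log N)
    (add_nonneg zero_le_one (Real.log_natCast_nonneg N))
  rw [← hN] at h
  refine le_trans (Finset.sum_le_sum fun y _ => ?_) h
  have hpos : 0 < min (acceptable (D y)).card (Fintype.card Y) :=
    lt_min (hD y) (Fintype.card_pos_iff.2 ⟨y⟩)
  split_ifs
  · exact le_rfl
  · refine add_le_add_right (Real.log_le_log (by exact_mod_cast hpos) ?_) _
    rw [hN]
    -- At most all of `X` is acceptable, so the minimum with the size of `Y` is at most `N`.
    exact_mod_cast min_le_min_right _ (Finset.card_le_univ _)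

end Main

end StableMarriage

theorem mainTheorem6 {M W : Type*} [Fintype M] [Fintype W] [DecidableEq M] [DecidableEq W]
    (DM : M → W → ℝ≥0) (DW : W → M → ℝ≥0)
    (hM : ∀ m, 1 ≤ (StableMarriage.acceptable (DM m)).card)
    (hW : ∀ w, 1 ≤ (StableMarriage.acceptable (DW w)).card)
    (r : ℝ) (hr : 1 ≤ r)
    (hfactor : ∀ m w, w ∈ StableMarriage.acceptable (DM m) →
      m ∈ StableMarriage.acceptable (DW w) →
      (DW w m : ℝ) ≤ r * DM m w ∧ (DM m w : ℝ) ≤ r * DW w m)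
    (N : ℕ) (hN : N = min (Fintype.card M) (Fintype.card W)) :
    StableMarriage.expectedStablePairs DM DW ≤
        N * (1 + Real.log r)
          + ∑ w, Real.log ((StableMarriage.acceptable (DW w)).card) / 2
          + ∑ m, Real.log ((StableMarriage.acceptable (DM m)).card) / 2 ∧
      (r = 1 →
        (∀ m w, w ∈ StableMarriage.acceptable (DM m) →
          m ∈ StableMarriage.acceptable (DW w) → DW w m = DM m w) ∧
        StableMarriage.expectedStablePairs DM DW ≤ N + N * Real.log N) := by
  have hN' : N = min (Fintype.card W) (Fintype.card M) := by rw [hN, min_comm]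
  refine ⟨?_, ?_⟩
  · have h := StableMarriage.two_mul_expectedStablePairs_le DM DW fun P Q hP hQ =>
      (StableMarriage.sum_gain_add_sum_gain_le hr hfactor hN hP hQ _ _).trans
        (add_le_add_left (add_le_add
          (StableMarriage.sum_one_add_log_le_sum _ hN DW hW)
          (StableMarriage.sum_one_add_log_le_sum _ hN' DM hM)) _)
    rw [← Finset.sum_div, ← Finset.sum_div]
    linarith
  · rintro rfl
    refine ⟨fun m w hm hw => ?_, ?_⟩
    · obtain ⟨h1, h2⟩ := hfactor m w hm hw
      rw [one_mul] at h1 h2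
      exact NNReal.coe_injective (le_antisymm h1 h2)
    · have h := StableMarriage.two_mul_expectedStablePairs_le DM DW fun P Q hP hQ =>
        (StableMarriage.sum_gain_add_sum_gain_le hr hfactor hN hP hQ _ _).trans
          (add_le_add_left (add_le_add
            (StableMarriage.sum_one_add_log_le_mul _ hN DW hW)
            (StableMarriage.sum_one_add_log_le_mul _ hN' DM hM)) _)
      rw [Real.log_one] at h
      linarith
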